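/- All graphs are finite, simple and nonnull. For a graph $H$, a graph $G$ is $H$-free if no induced subgraph of $G$ is isomorphic to $H$, and $G$ is $(H_1,\dots,H_k)$-free if it is $H_i$-free for every $i$. Here $2P_3$ is the disjoint union of two three-vertex paths and $C_k$ is the cycle on $k$ vertices. A clique is a (possibly empty) set of pairwise adjacent vertices, and a vertex is simplicial if its neighbors form a clique. A graph is anticonnected if its complement is connected; an anticomponent of $G$ is a maximal anticonnected induced subgraph of $G$, and it is nontrivial if it has at least two vertices. Two disjoint vertex sets are complete (resp. anticomplete) to each other if all (resp. none) of the possible edges between them are present; a vertex $v$ is complete (resp. anticomplete) to a set $Y \not\ni v$ if $\{v\}$ is. A thickening of a graph $G$ is a graph $G^*$ for which there is a family $\{X_v\}_{v\in V(G)}$ of pairwise disjoint nonempty sets with $V(G^*)=\bigcup_{v\in V(G)}X_v$, such that each $X_v$ is a clique of $G^*$ and, for distinct $u,v\in V(G)$, the sets $X_u$ and $X_v$ are complete to each other in $G^*$ if $u,v$ are adjacent in $G$, and anticomplete to each other in $G^*$ otherwise. A graph $G$ is obtained from a graph $Q$ by possibly adding universal vertices if $Q$ is an induced subgraph of $G$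 and $V(G)\setminus V(Q)$ is a (possibly empty) clique of $G$, complete to $V(Q)$. The following graphs are used. * $M_0$ has vertices $x_0,\dots,x_6,y_0,y_3,z_0,z_3,z_4$; the vertices $x_0,x_1,\dots,x_6,x_0$ form, in this order, an induced $7$-cycle; $\{y_0,y_3,z_0,z_3,z_4\}$ is a clique; and the neighbors among the $x_i$ are: $\{x_0,x_1,x_4\}$ for $y_0$, $\{x_3,x_4,x_0\}$ for $y_3$, $\{x_0,x_1,x_2,x_3,x_4\}$ for $z_0$, $\{x_3,x_4,x_5,x_6,x_0\}$ for $z_3$, and $\{x_4,x_5,x_6,x_0,x_1\}$ for $z_4$. * $M_1$ has vertices $x_0,\dots,x_6,y_0,z_2$; the vertices $x_0,x_1,\dots,x_6,x_0$ form, in this order, an induced $7$-cycle; $y_0$ has neighbors $x_0,x_1,x_4$ only, and $z_2$ has neighbors $x_2,x_3,x_4,x_5,x_6$ only. * $M_2$ is $M_1$ with an additional vertex $z_1$ whose neighbors are $x_1,x_2,x_3,x_4,x_5,y_0,z_2$. * $M_3$ is $M_1$ with an additional vertex $z_3$ whose neighbors are $x_3,x_4,x_5,x_6,x_0,y_0,z_2$.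 * $\mathcal M=\{M_0\setminus S \mid S\subseteq\{y_0,y_3,z_0,z_3,z_4\}\}\cup\{M_1,M_2,M_3\}$. * $T_0$ has vertices $a_0,a_1,b_0,b_1,b_2,b_3,c_1,c_2,c_3$ and exactly the edges $a_0a_1$, $a_0b_0$, $a_0b_2$, $a_0b_3$, $a_1b_1$, $a_1b_2$, $a_1b_3$, $c_1c_2$, $c_1c_3$, $c_2c_3$, $c_1b_0$, $c_1b_1$, $c_2b_2$, $c_3b_3$. * $T_1$ is $T_0$ with an additional vertex $f_3$ whose neighbors are $a_0,a_1,b_0,b_1,b_2,c_1,c_2$. **Theorem.** For any graph $G$, the following are equivalent: (a) $G$ is $(2P_3,C_4,C_6)$-free, contains an induced $C_7$ or an induced $T_0$, and contains no simplicial vertices; (b) $G$ has exactly one nontrivial anticomponent, and this anticomponent is a thickening of a graph in $\mathcal M\cup\{T_0,T_1\}$; (c) $G$ can be obtained from a thickening of a graph in $\mathcal M\cup\{T_0,T_1\}$ by possibly adding universal vertices to it. -/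

import Mathlib

namespace EvenHole

/-- `G` is `H`-free: no induced subgraph of `G` is isomorphic to `H`. -/
def IndFree {V W : Type*} (G : SimpleGraph V) (H : SimpleGraph W) : Prop :=
  ¬ SimpleGraph.IsIndContained H G

/-- `2P₃`, the disjoint union of two paths on three vertices. -/
def twoP3 : SimpleGraph (Fin 3 ⊕ Fin 3) :=
  SimpleGraph.sum (SimpleGraph.pathGraph 3) (SimpleGraph.pathGraph 3)

/-- A vertex is simplicial if its neighbours form a (possibly empty) clique. -/
def IsSimplicial {V : Type*} (G : SimpleGraph V) (v : V) : Prop :=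
  G.IsClique (G.neighborSet v)

/-- A graph is anticonnected if its complement is connected. -/
def Anticonnected {V : Type*} (G : SimpleGraph V) : Prop := Gᶜ.Connected

/-- `Q` is the vertex set of an anticomponent of `G`, that is, of a maximal anticonnected induced
subgraph of `G`. -/
def IsAnticomponent {V : Type*} (G : SimpleGraph V) (Q : Set V) : Prop :=
  Maximal (fun S : Set V => Anticonnected (G.induce S)) Q

/-- An anticomponent with at least two vertices. -/
def IsNontrivialAnticomponent {V : Type*} (G : SimpleGraph V) (Q : Set V) : Prop :=
  IsAnticomponent G Q ∧ Q.Nontrivial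

/-- Every vertex of `X` is adjacent to every vertex of `Y`. -/
def CompleteTo {V : Type*} (G : SimpleGraph V) (X Y : Set V) : Prop :=
  ∀ x ∈ X, ∀ y ∈ Y, G.Adj x y

/-- No vertex of `X` is adjacent to a vertex of `Y`. -/
def AnticompleteTo {V : Type*} (G : SimpleGraph V) (X Y : Set V) : Prop :=
  ∀ x ∈ X, ∀ y ∈ Y, ¬ G.Adj x y

/-- `Gs` is a thickening of `G`. -/
def IsThickening {V W : Type*} (Gs : SimpleGraph V) (G : SimpleGraph W) : Prop :=
  ∃ X : W → Set V,
    (∀ v, (X v).Nonempty) ∧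
    (∀ u v, u ≠ v → Disjoint (X u) (X v)) ∧
    (⋃ v, X v) = Set.univ ∧
    (∀ v, Gs.IsClique (X v)) ∧
    (∀ u v, u ≠ v → G.Adj u v → CompleteTo Gs (X u) (X v)) ∧
    (∀ u v, u ≠ v → ¬ G.Adj u v → AnticompleteTo Gs (X u) (X v))

/-- `G` can be obtained from its induced subgraph on `S` by possibly adding universal vertices:
the vertices outside `S` form a (possibly empty) clique, complete to `S`. -/
def ObtainedByAddingUniversal {V : Type*} (G : SimpleGraph V) (S : Set V) : Prop :=
  G.IsClique Sᶜ ∧ CompleteTo G Sᶜ S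

/-! Each concrete graph below is given by listing, for every vertex `u`, some of its neighbours
(`later u`); each edge is listed from at least one of its two ends. -/

/-- Vertices of `M₀`. -/
inductive M0Vertex
  | x (i : Fin 7) | y0 | y3 | z0 | z3 | z4
  deriving DecidableEq

namespace M0Vertex

/-- `x₀, …, x₆, x₀` is a 7-hole and `{y₀, y₃, z₀, z₃, z₄}` is a clique. -/
def later : M0Vertex → List M0Vertex
  | x i => [x (i + 1)]
  | y0 => [x 0, x 1, x 4, y3, z0, z3, z4]
  | y3 => [x 3, x 4, x 0, z0, z3, z4]
  | z0 => [x 0, x 1, x 2, x 3, x 4, z3, z4]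
  | z3 => [x 3, x 4, x 5, x 6, x 0, z4]
  | z4 => [x 4, x 5, x 6, x 0, x 1]

end M0Vertex

/-- The graph `M₀`. -/
def M0 : SimpleGraph M0Vertex := SimpleGraph.fromRel fun u v => v ∈ u.later

/-- Vertices of `M₁`. -/
inductive M1Vertex
  | x (i : Fin 7) | y0 | z2
  deriving DecidableEq

namespace M1Vertex

/-- `x₀, …, x₆, x₀` is a 7-hole; `y₀` and `z₂` are nonadjacent. -/
def later : M1Vertex → List M1Vertex
  | x i => [x (i + 1)]
  | y0 => [x 0, x 1, x 4]
  | z2 => [x 2, x 3, x 4, x 5, x 6]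

end M1Vertex

/-- The graph `M₁`. -/
def M1 : SimpleGraph M1Vertex := SimpleGraph.fromRel fun u v => v ∈ u.later

/-- Vertices of `M₂`. -/
inductive M2Vertex
  | x (i : Fin 7) | y0 | z1 | z2
  deriving DecidableEq

namespace M2Vertex

/-- `M₁` together with a vertex `z₁`. -/
def later : M2Vertex → List M2Vertex
  | x i => [x (i + 1)]
  | y0 => [x 0, x 1, x 4]
  | z2 => [x 2, x 3, x 4, x 5, x 6]
  | z1 => [x 1, x 2, x 3, x 4, x 5, y0, z2]

end M2Vertex

/-- The graph `M₂`. -/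
def M2 : SimpleGraph M2Vertex := SimpleGraph.fromRel fun u v => v ∈ u.later

/-- Vertices of `M₃`. -/
inductive M3Vertex
  | x (i : Fin 7) | y0 | z2 | z3
  deriving DecidableEq

namespace M3Vertex

/-- `M₁` together with a vertex `z₃`. -/
def later : M3Vertex → List M3Vertex
  | x i => [x (i + 1)]
  | y0 => [x 0, x 1, x 4]
  | z2 => [x 2, x 3, x 4, x 5, x 6]
  | z3 => [x 3, x 4, x 5, x 6, x 0, y0, z2]

end M3Vertex

/-- The graph `M₃`. -/
def M3 : SimpleGraph M3Vertex := SimpleGraph.fromRel fun u v => v ∈ u.later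

/-- Vertices of `T₀`. -/
inductive T0Vertex
  | a0 | a1 | b0 | b1 | b2 | b3 | c1 | c2 | c3
  deriving DecidableEq

namespace T0Vertex

/-- `{c₁, c₂, c₃}` is a clique, `a₀a₁` is an edge, and `b₀, b₁, b₂, b₃` are pairwise
nonadjacent. -/
def later : T0Vertex → List T0Vertex
  | a0 => [a1, b0, b2, b3]
  | a1 => [b1, b2, b3]
  | b0 => []
  | b1 => []
  | b2 => []
  | b3 => []
  | c1 => [b0, b1, c2, c3]
  | c2 => [b2, c3]
  | c3 => [b3]

end T0Vertex

/-- The graph `T₀`. -/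
def T0 : SimpleGraph T0Vertex := SimpleGraph.fromRel fun u v => v ∈ u.later

/-- Vertices of `T₁`. -/
inductive T1Vertex
  | a0 | a1 | b0 | b1 | b2 | b3 | c1 | c2 | c3 | f3
  deriving DecidableEq

namespace T1Vertex

/-- `T₀` together with a vertex `f₃` whose only nonneighbours are `b₃` and `c₃`. -/
def later : T1Vertex → List T1Vertex
  | a0 => [a1, b0, b2, b3]
  | a1 => [b1, b2, b3]
  | b0 => []
  | b1 => []
  | b2 => []
  | b3 => []
  | c1 => [b0, b1, c2, c3]
  | c2 => [b2, c3]
  | c3 => [b3]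
  | f3 => [a0, a1, b0, b1, b2, c1, c2]

end T1Vertex

/-- The graph `T₁`. -/
def T1 : SimpleGraph T1Vertex := SimpleGraph.fromRel fun u v => v ∈ u.later

/-- The family `𝓜`: all `M₀ ∖ S` with `S ⊆ {y₀, y₃, z₀, z₃, z₄}`, and `M₁`, `M₂`, `M₃`. -/
def familyM : Set (Σ W : Type, SimpleGraph W) :=
  {H | ∃ S : Set M0Vertex,
      S ⊆ {M0Vertex.y0, M0Vertex.y3, M0Vertex.z0, M0Vertex.z3, M0Vertex.z4} ∧
      H = ⟨↥(Sᶜ), M0.induce Sᶜ⟩} ∪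
  {⟨M1Vertex, M1⟩, ⟨M2Vertex, M2⟩, ⟨M3Vertex, M3⟩}

end EvenHole

/-! Work with closed adjacency, "equal or adjacent". A thickening of `H` with universal vertices
added is then a pullback: its closed adjacency is induced by a map `φ : V → Option W` from that of
`H` with a universal vertex `none`, and the parts of the thickening are fibres of `φ`
(`IsBlowupOn.exists_thickening`, `isBlowupOn_of_thickening`). None of C₄, C₆, 2P₃, C₇, T₀ has true
twins, so an induced copy of one of them is described by closed adjacency alone, distinctness being
automatic. Hence freeness needs checking only on the targets, and (c) implies (a).

For (a) implies (c), fix an induced C₇ or T₀ and record each vertex of `G` by its mask, that is, its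
trace on this copy. A finite search (`exists_type`) shows that few masks avoid a forbidden subgraph.
The unwanted survivors are the masks of vertices anticomplete to the copy and, over T₀, of those
seeing only `c₂` and `c₃`. They are excluded because a vertex of such a mask with fewest neighbours
would be simplicial (`not_hasMask_of_eliminationCheck`). Over C₇, the sets of masks that can coexist
fit M₀, M₁, M₂ or M₃ up to dihedral symmetry (`exists_labelling_C7`); over T₀, two additional masks
exclude each other and are exchanged by an automorphism. Within a target, two masks determine the
adjacency of their vertices, since the other choice creates a forbidden subgraph, so `G` is a blowup
of the target (`isBlowupOn_of_targetCheck`).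

For (b) and (c): the targets are anticonnected with at least two vertices, so their thickenings are
too, and a universal vertex lies in no nontrivial anticomponent. Conversely, any nonadjacent pair
lies in a nontrivial anticomponent, so uniqueness makes all vertices outside it universal. -/

namespace EvenHole

/-! ### Closed adjacency -/

section ClosedAdjacency

variable {V W : Type*}

open Classical in
/-- Closed adjacency: `u` and `v` are equal or adjacent. -/
noncomputable def closedAdj (G : SimpleGraph V) (u v : V) : Bool := decide (u = v ∨ G.Adj u v)

theorem closedAdj_iff {G : SimpleGraph V} {u v : V} :
    closedAdj G u v = true ↔ u = v ∨ G.Adj u v := by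
  simp [closedAdj]

theorem closedAdj_eq_false_iff {G : SimpleGraph V} {u v : V} :
    closedAdj G u v = false ↔ u ≠ v ∧ ¬ G.Adj u v := by
  simp [closedAdj]

@[simp] theorem closedAdj_self (G : SimpleGraph V) (u : V) : closedAdj G u u = true := by
  simp [closedAdj]

theorem closedAdj_comm (G : SimpleGraph V) (u v : V) : closedAdj G u v = closedAdj G v u := by
  rw [Bool.eq_iff_iff, closedAdj_iff, closedAdj_iff, G.adj_comm, eq_comm]

theorem closedAdj_fromRel [DecidableEq V] (l : V → List V) (u v : V) :
    closedAdj (SimpleGraph.fromRel fun a b => b ∈ l a) u v =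
      (decide (u = v) || (l u).contains v || (l v).contains u) := by
  rw [Bool.eq_iff_iff, closedAdj_iff]
  simp only [SimpleGraph.fromRel_adj, Bool.or_eq_true, decide_eq_true_eq, List.contains_iff_mem]
  tauto

/-- A map preserving closed adjacency from a graph without true twins is an induced copy. -/
theorem isIndContained_of_closedAdj {H : SimpleGraph W} {G : SimpleGraph V} (f : W → V)
    (hf : ∀ a b, closedAdj G (f a) (f b) = closedAdj H a b)
    (twins : ∀ a b, (∀ c, closedAdj H a c = closedAdj H b c) → a = b) :
    SimpleGraph.IsIndContained H G := by
  have inj : Function.Injective f := fun a b h =>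
    twins a b fun c => by rw [← hf, ← hf, h]
  refine ⟨⟨⟨f, inj⟩, fun {a b} => ?_⟩⟩
  have := hf a b
  rw [Bool.eq_iff_iff, closedAdj_iff, closedAdj_iff, inj.eq_iff] at this
  by_cases hab : a = b
  · subst hab; simp
  · simpa [hab] using this

theorem closedAdj_embedding {H : SimpleGraph W} {G : SimpleGraph V} (f : H ↪g G) (a b : W) :
    closedAdj G (f a) (f b) = closedAdj H a b := by
  rw [Bool.eq_iff_iff, closedAdj_iff, closedAdj_iff]
  simp

/-- Closed adjacency in the graph obtained from `H` by adding a universal vertex `none`. -/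
noncomputable def univClosedAdj (H : SimpleGraph W) : Option W → Option W → Bool
  | some a, some b => closedAdj H a b
  | _, _ => true

end ClosedAdjacency

/-! ### Forbidden induced subgraphs as patterns of closed adjacency -/

section Occurrences

variable {V W : Type*}

/-- There are vertices satisfying the given predicates, in this order, such that each vertex is
related to the later ones as its column of the pattern says. -/
def Occurs (r : V → V → Bool) : List (List Bool) → List (V → Prop) → Prop
  | col :: cols, P :: Ps =>
    ∃ v, P v ∧ Occurs r cols (List.zipWith (fun b P u => P u ∧ r v u = b) col Ps)
  | _, _ => True

/-- Columns of a four-cycle. -/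
def squareCols : List (List Bool) := [[true, false, true], [true, false], [true], []]

/-- Columns of a six-cycle. -/
def hexagonCols : List (List Bool) :=
  [[true, false, false, false, true], [true, false, false, false], [true, false, false],
    [true, false], [true], []]

/-- Columns of `2P₃`, starting with an end of one of the paths. -/
def pathsEndCols : List (List Bool) :=
  [[true, false, false, false, false], [true, false, false, false], [false, false, false],
    [true, false], [true], []]

/-- Columns of `2P₃`, starting with the middle of one of the paths. -/
def pathsMidCols : List (List Bool) :=
  [[true, true, false, false, false], [false, false, false, false], [false, false, false],
    [true, false], [true], []]

/-- The pattern with the given columns occurs. -/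
def HasPattern (r : V → V → Bool) (cols : List (List Bool)) : Prop :=
  Occurs r cols (List.replicate cols.length fun _ => True)

/-- None of the three forbidden patterns occurs. -/
def PatternFree (r : V → V → Bool) : Prop :=
  ¬ HasPattern r squareCols ∧ ¬ HasPattern r hexagonCols ∧ ¬ HasPattern r pathsEndCols

theorem forall₂_replicate {α β : Type*} {R : α → β → Prop} {a : α} {b : β} (h : R a b) :
    ∀ n : ℕ, List.Forall₂ R (List.replicate n a) (List.replicate n b)
  | 0 => .nil
  | n + 1 => .cons h (forall₂_replicate h n)

theorem forall₂_zipWith {α β γ : Type*} {R : α → β → Prop} {f : γ → α → α} {g : γ → β → β}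
    (h : ∀ c a b, R a b → R (f c a) (g c b)) : ∀ (l : List γ) {as : List α} {bs : List β},
    List.Forall₂ R as bs → List.Forall₂ R (List.zipWith f l as) (List.zipWith g l bs)
  | [], _, _, _ => .nil
  | _ :: _, _, _, .nil => .nil
  | c :: l, _, _, .cons hab h' => .cons (h c _ _ hab) (forall₂_zipWith h l h')

/-- A pattern mentions only the relation, never equality, so `φ` need not be injective. This is what
lets blowups collapse to their target. -/
theorem Occurs.map {r : V → V → Bool} {s : W → W → Bool} {φ : V → W}
    (h : ∀ u v, r u v = s (φ u) (φ v)) :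
    ∀ {cols : List (List Bool)} {Ps : List (V → Prop)} {Qs : List (W → Prop)},
      List.Forall₂ (fun P Q => ∀ v, P v → Q (φ v)) Ps Qs → Occurs r cols Ps → Occurs s cols Qs
  | [], _, _, _, _ => by simp [Occurs]
  | _ :: _, _, _, .nil, _ => by simp [Occurs]
  | col :: cols, _, _, .cons hPQ hPQs, ⟨v, hv, ho⟩ => by
    refine ⟨φ v, hPQ v hv, Occurs.map h (forall₂_zipWith ?_ col hPQs) ho⟩
    exact fun b P Q hP u hu => ⟨hP u hu.1, by rw [← h, hu.2]⟩

theorem HasPattern.map {r : V → V → Bool} {s : W → W → Bool} {φ : V → W}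
    (h : ∀ u v, r u v = s (φ u) (φ v)) {cols : List (List Bool)} (hr : HasPattern r cols) :
    HasPattern s cols :=
  Occurs.map h (forall₂_replicate (fun _ _ => trivial) _) hr

theorem PatternFree.comap {r : V → V → Bool} {s : W → W → Bool} {φ : V → W}
    (h : ∀ u v, r u v = s (φ u) (φ v)) (hs : PatternFree s) : PatternFree r :=
  ⟨fun ho => hs.1 (ho.map h), fun ho => hs.2.1 (ho.map h), fun ho => hs.2.2 (ho.map h)⟩

/-- The pattern does not ask for distinct vertices; distinctness follows because no two vertices of
the four-cycle have the same closed neighbourhood. -/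
theorem hasPattern_square_iff {G : SimpleGraph V} :
    HasPattern (closedAdj G) squareCols ↔
      SimpleGraph.IsIndContained (SimpleGraph.cycleGraph 4) G := by
  have hC : ∀ i j : Fin 4, closedAdj (SimpleGraph.cycleGraph 4) i j =
      decide (i = j ∨ (SimpleGraph.cycleGraph 4).Adj i j) := fun i j => by simp [closedAdj]
  constructor
  · rintro ⟨a, -, b, hb, c, hc, d, hd, -⟩
    simp at hb hc hd
    refine isIndContained_of_closedAdj ![a, b, c, d] (fun i j => ?_) ?_
    · rw [hC]
      fin_cases i <;> fin_cases j <;>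
        simp [hb, hc, hd, closedAdj_comm G _ a, closedAdj_comm G c b, closedAdj_comm G d b,
          closedAdj_comm G d c] <;> decide
    · simp only [hC]; decide
  · rintro ⟨f⟩
    have h := closedAdj_embedding f
    simp only [hC] at h
    refine ⟨f 0, trivial, f 1, ?_, f 2, ?_, f 3, ?_, trivial⟩ <;> simp only [h] <;> decide

theorem hasPattern_hexagon_iff {G : SimpleGraph V} :
    HasPattern (closedAdj G) hexagonCols ↔
      SimpleGraph.IsIndContained (SimpleGraph.cycleGraph 6) G := by
  have hC : ∀ i j : Fin 6, closedAdj (SimpleGraph.cycleGraph 6) i j =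
      decide (i = j ∨ (SimpleGraph.cycleGraph 6).Adj i j) := fun i j => by simp [closedAdj]
  constructor
  · rintro ⟨a, -, b, hb, c, hc, d, hd, e, he, f, hf, -⟩
    simp at hb hc hd he hf
    refine isIndContained_of_closedAdj ![a, b, c, d, e, f] (fun i j => ?_) ?_
    · rw [hC]
      fin_cases i <;> fin_cases j <;>
        simp [hb, hc, hd, he, hf, closedAdj_comm G _ a, closedAdj_comm G c b, closedAdj_comm G d b,
          closedAdj_comm G e b, closedAdj_comm G f b, closedAdj_comm G d c, closedAdj_comm G e c,
          closedAdj_comm G f c, closedAdj_comm G e d, closedAdj_comm G f d,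
          closedAdj_comm G f e] <;> decide
    · simp only [hC]; decide
  · rintro ⟨f⟩
    have h := closedAdj_embedding f
    simp only [hC] at h
    refine ⟨f 0, trivial, f 1, ?_, f 2, ?_, f 3, ?_, f 4, ?_, f 5, ?_, trivial⟩ <;>
      simp only [h] <;> decide

theorem closedAdj_twoP3 (i j : Fin 3 ⊕ Fin 3) : closedAdj twoP3 i j =
    match i, j with
    | .inl a, .inl b => decide (a.val ≤ b.val + 1 ∧ b.val ≤ a.val + 1)
    | .inr a, .inr b => decide (a.val ≤ b.val + 1 ∧ b.val ≤ a.val + 1)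
    | _, _ => false := by
  have key : ∀ a b : Fin 3, (a = b ∨ (SimpleGraph.pathGraph 3).Adj a b) ↔
      (a.val ≤ b.val + 1 ∧ b.val ≤ a.val + 1) := fun a b => by
    rw [SimpleGraph.pathGraph_adj, Fin.ext_iff]; omega
  rcases i with a | a <;> rcases j with b | b <;>
    rw [Bool.eq_iff_iff, closedAdj_iff] <;>
    simp [twoP3, ← key, -Bool.decide_and]

theorem hasPattern_pathsEnd_iff {G : SimpleGraph V} :
    HasPattern (closedAdj G) pathsEndCols ↔ SimpleGraph.IsIndContained twoP3 G := by
  constructor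
  · rintro ⟨a, -, b, hb, c, hc, d, hd, e, he, f, hf, -⟩
    simp at hb hc hd he hf
    refine isIndContained_of_closedAdj (Sum.elim ![a, b, c] ![d, e, f]) (fun i j => ?_) ?_
    · rw [closedAdj_twoP3]
      rcases i with i | i <;> rcases j with j | j <;> fin_cases i <;> fin_cases j <;>
        simp [hb, hc, hd, he, hf, closedAdj_comm G _ a, closedAdj_comm G c b, closedAdj_comm G d b,
          closedAdj_comm G e b, closedAdj_comm G f b, closedAdj_comm G d c, closedAdj_comm G e c,
          closedAdj_comm G f c, closedAdj_comm G e d, closedAdj_comm G f d,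
          closedAdj_comm G f e]
    · simp only [closedAdj_twoP3]; decide
  · rintro ⟨f⟩
    have h := closedAdj_embedding f
    simp only [closedAdj_twoP3] at h
    refine ⟨f (.inl 0), trivial, f (.inl 1), ?_, f (.inl 2), ?_, f (.inr 0), ?_, f (.inr 1), ?_,
      f (.inr 2), ?_, trivial⟩ <;>
      simp only [h] <;> decide

/-- Searches through a prescribed vertex need both forms: that vertex can be an end or a middle of a
path. The two cycles are vertex-transitive and need one form only. -/
theorem HasPattern.pathsEnd_of_pathsMid {r : V → V → Bool} (symm : ∀ u v, r u v = r v u)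
    (h : HasPattern r pathsMidCols) : HasPattern r pathsEndCols := by
  obtain ⟨b, -, a, ha, c, hc, d, hd, e, he, f, hf, -⟩ := h
  simp at ha hc hd he hf
  refine ⟨a, trivial, b, ?_, c, ?_, d, ?_, e, ?_, f, ?_, trivial⟩ <;>
    simp [ha, hc, hd, he, hf, symm a b]

theorem patternFree_closedAdj_iff {G : SimpleGraph V} :
    PatternFree (closedAdj G) ↔ IndFree G twoP3 ∧ IndFree G (SimpleGraph.cycleGraph 4) ∧
      IndFree G (SimpleGraph.cycleGraph 6) := by
  rw [IndFree, IndFree, IndFree, ← hasPattern_square_iff, ← hasPattern_hexagon_iff,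
    ← hasPattern_pathsEnd_iff, PatternFree]
  tauto

end Occurrences

/-! ### Kernel-computable codes of graphs and the search for patterns -/

section Codes

variable {V : Type*}

/-! Finite graphs are coded by the list of their closed adjacency rows, each row a number whose bits
are the entries. The functions below are written with recursors and raw operations on natural
numbers, which the kernel evaluates fast. -/

/-- Bit `i` of `m`. -/
def bitAt (m i : ℕ) : Bool := Nat.beq (Nat.land 1 (Nat.shiftRight m i)) 1

theorem bitAt_eq_testBit (m i : ℕ) : bitAt m i = m.testBit i := by
  have h : Nat.land 1 (Nat.shiftRight m i) = (m >>> i) % 2 := Nat.one_and_eq_mod_two _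
  rw [Bool.eq_iff_iff, bitAt, Nat.beq_eq, h, Nat.testBit_eq_decide_div_mod_eq,
    decide_eq_true_iff, Nat.shiftRight_eq_div_pow]

/-- The `n`-th entry of a list, or `0`. -/
noncomputable def nthRow (l : List ℕ) : ℕ → ℕ :=
  List.rec (fun _ => 0) (fun a _ ih n => Nat.rec a (fun n _ => ih n) n) l

/-- Some entry of a list satisfies `p`. -/
noncomputable def anyEntry (p : ℕ → Bool) (l : List ℕ) : Bool :=
  List.rec false (fun a _ ih => cond (p a) true ih) l

theorem anyEntry_iff {p : ℕ → Bool} : ∀ {l : List ℕ}, anyEntry p l = true ↔ ∃ i ∈ l, p i = true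
  | [] => by simp [anyEntry]
  | a :: l => by
    change cond (p a) true (anyEntry p l) = true ↔ _
    rw [List.exists_mem_cons_iff, ← anyEntry_iff (l := l)]
    cases p a <;> simp

/-- Put the bits of `m` in front of the rows of `g`. -/
noncomputable def addColumn (g : List ℕ) : ℕ → List ℕ :=
  List.rec (fun _ => [])
    (fun r _ ih m => Nat.add (Nat.mul 2 r) (Nat.mod m 2) :: ih (Nat.div m 2)) g

/-- Add to `g` a new vertex, in position `0`, with mask `m`. -/
noncomputable def addVertex (m : ℕ) (g : List ℕ) : List ℕ :=
  Nat.add (Nat.mul 2 m) 1 :: addColumn g m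

/-- Closed adjacency of positions `p` and `q`. -/
noncomputable def codeAdj (g : List ℕ) (p q : ℕ) : Bool := bitAt (nthRow g p) q

/-- The bits of `M` at which `row` has bit `b`. -/
def restrict (row : ℕ) (b : Bool) (M : ℕ) : ℕ :=
  cond b (Nat.land M row) (Nat.xor M (Nat.land M row))

/-- Apply `restrict` along a column. -/
noncomputable def restrictAll (row : ℕ) (col : List Bool) : List ℕ → List ℕ :=
  List.rec (fun _ => [])
    (fun b _ ih Ms => List.rec [] (fun M Ms _ => restrict row b M :: ih Ms) Ms) col

/-- Search for a pattern in the graph coded by `g`, among the positions in `idx`; the candidates for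
each vertex of the pattern are the bits of the corresponding entry of the last argument. -/
noncomputable def finds (idx g : List ℕ) (cols : List (List Bool)) : List ℕ → Bool :=
  List.rec (fun _ => true)
    (fun col _ ih Ms => List.rec true
      (fun M Ms _ => cond (Nat.beq M 0) false
        (anyEntry (fun i => cond (bitAt M i) (ih (restrictAll (nthRow g i) col Ms)) false) idx))
      Ms) cols

theorem testBit_two_mul_add_one_succ (m q : ℕ) :
    (Nat.add (Nat.mul 2 m) 1).testBit (q + 1) = m.testBit q := by
  rw [Nat.testBit_succ]
  congr 1
  change (2 * m + 1) / 2 = m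
  omega

theorem nthRow_addColumn_succ : ∀ (g : List ℕ) (m p q : ℕ), p < g.length →
    (nthRow (addColumn g m) p).testBit (q + 1) = (nthRow g p).testBit q
  | r :: g, m, 0, q, _ => by
    change (2 * r + m % 2).testBit (q + 1) = r.testBit q
    rw [Nat.testBit_succ]
    congr 1
    omega
  | r :: g, m, p + 1, q, hp => nthRow_addColumn_succ g (m / 2) p q (by simpa using hp)

theorem nthRow_addColumn_zero : ∀ (g : List ℕ) (m p : ℕ), p < g.length →
    (nthRow (addColumn g m) p).testBit 0 = m.testBit p
  | r :: g, m, 0, _ => by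
    change (2 * r + m % 2).testBit 0 = m.testBit 0
    simp [Nat.testBit_zero, Nat.add_mod]
  | r :: g, m, p + 1, hp => by
    rw [Nat.testBit_succ]
    exact nthRow_addColumn_zero g (m / 2) p (by simpa using hp)

theorem length_addColumn : ∀ (g : List ℕ) (m : ℕ), (addColumn g m).length = g.length
  | [], _ => rfl
  | _ :: g, m => congrArg Nat.succ (length_addColumn g (m / 2))

theorem length_addVertex (m : ℕ) (g : List ℕ) : (addVertex m g).length = g.length + 1 :=
  congrArg Nat.succ (length_addColumn g m)

theorem codeAdj_addVertex_zero_zero (m : ℕ) (g : List ℕ) :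
    codeAdj (addVertex m g) 0 0 = true := by
  rw [codeAdj, bitAt_eq_testBit]
  change (2 * m + 1).testBit 0 = true
  simp [Nat.testBit_zero]

theorem codeAdj_addVertex_zero_succ (m : ℕ) (g : List ℕ) (q : ℕ) :
    codeAdj (addVertex m g) 0 (q + 1) = m.testBit q := by
  rw [codeAdj, bitAt_eq_testBit]
  exact testBit_two_mul_add_one_succ m q

theorem codeAdj_addVertex_succ_zero (m : ℕ) {g : List ℕ} {p : ℕ} (hp : p < g.length) :
    codeAdj (addVertex m g) (p + 1) 0 = m.testBit p := by
  rw [codeAdj, bitAt_eq_testBit]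
  exact nthRow_addColumn_zero g m p hp

theorem codeAdj_addVertex_succ_succ (m : ℕ) {g : List ℕ} {p : ℕ} (hp : p < g.length) (q : ℕ) :
    codeAdj (addVertex m g) (p + 1) (q + 1) = codeAdj g p q := by
  rw [codeAdj, codeAdj, bitAt_eq_testBit, bitAt_eq_testBit]
  exact nthRow_addColumn_succ g m p q hp

theorem testBit_restrict (row : ℕ) (b : Bool) (M i : ℕ) :
    (restrict row b M).testBit i = (M.testBit i && (row.testBit i == b)) := by
  cases b
  · change (M ^^^ (M &&& row)).testBit i = _
    rw [Nat.testBit_xor, Nat.testBit_and]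
    cases M.testBit i <;> cases row.testBit i <;> rfl
  · change (M &&& row).testBit i = _
    rw [Nat.testBit_and, beq_true]

theorem restrictAll_eq (row : ℕ) : ∀ (col : List Bool) (Ms : List ℕ),
    restrictAll row col Ms = List.zipWith (restrict row) col Ms
  | [], _ => by simp [restrictAll]
  | _ :: _, [] => rfl
  | b :: col, M :: Ms => congrArg (restrict row b M :: ·) (restrictAll_eq row col Ms)

theorem finds_cons_cons (idx g : List ℕ) (col : List Bool) (cols : List (List Bool)) (M : ℕ)
    (Ms : List ℕ) : finds idx g (col :: cols) (M :: Ms) = true ↔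
      ∃ i ∈ idx, M.testBit i = true ∧
        finds idx g cols (List.zipWith (restrict (nthRow g i)) col Ms) = true := by
  change cond (Nat.beq M 0) false (anyEntry (fun i => cond (bitAt M i)
    (finds idx g cols (restrictAll (nthRow g i) col Ms)) false) idx) = true ↔ _
  have hM : Nat.beq M 0 = decide (M = 0) := by
    rw [Bool.eq_iff_iff, Nat.beq_eq, decide_eq_true_iff]
  simp only [Bool.cond_false_left, Bool.and_eq_true, Bool.not_eq_true', anyEntry_iff,
    Bool.cond_false_right, bitAt_eq_testBit, restrictAll_eq, hM, decide_eq_false_iff_not]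
  -- The test for an empty candidate set only prunes the search: a candidate `i` already makes `M`
  -- nonzero.
  refine ⟨fun h => h.2, fun h => ⟨?_, h⟩⟩
  rintro rfl
  obtain ⟨i, -, hi, -⟩ := h
  simp at hi

/-- The first terms of `c` realize the closed adjacency coded by `g`. -/
def IsCopy (r : V → V → Bool) (g : List ℕ) (c : ℕ → V) : Prop :=
  ∀ p < g.length, ∀ q < g.length, r (c p) (c q) = codeAdj g p q

/-- The bits of `m` describe the relation of `v` to the first `n` terms of `c`. -/
def HasMask (r : V → V → Bool) (n : ℕ) (c : ℕ → V) (v : V) (m : ℕ) : Prop :=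
  ∀ i < n, r v (c i) = m.testBit i

/-- The sequence `v, c 0, c 1, …`. -/
def prepend (v : V) (c : ℕ → V) : ℕ → V
  | 0 => v
  | i + 1 => c i

theorem IsCopy.addVertex {r : V → V → Bool} (refl : ∀ v, r v v = true)
    (symm : ∀ u v, r u v = r v u) {g : List ℕ} {c : ℕ → V} (hc : IsCopy r g c) {v : V} {m : ℕ}
    (hm : HasMask r g.length c v m) : IsCopy r (addVertex m g) (prepend v c) := by
  intro p hp q hq
  rw [length_addVertex] at hp hq
  match p, q, hp, hq with
  | 0, 0, _, _ => rw [codeAdj_addVertex_zero_zero]; exact refl v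
  | 0, q + 1, _, hq => rw [codeAdj_addVertex_zero_succ]; exact hm q (by omega)
  | p + 1, 0, hp, _ =>
    rw [symm, codeAdj_addVertex_succ_zero m (by omega)]; exact hm p (by omega)
  | p + 1, q + 1, hp, hq =>
    rw [codeAdj_addVertex_succ_succ m (by omega)]; exact hc p (by omega) q (by omega)

/-- The new vertex takes position `0`, so the old bits shift up by one and `b` becomes the lowest
bit. -/
theorem HasMask.prepend {r : V → V → Bool} {n : ℕ} {c : ℕ → V} {u v : V} {m : ℕ}
    (hm : HasMask r n c v m) {b : Bool} (hb : r v u = b) :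
    HasMask r (n + 1) (prepend u c) v (2 * m + b.toNat)
  | 0, _ => by rw [EvenHole.prepend, hb]; cases b <;> simp [Nat.testBit_zero]
  | i + 1, hi => by
    rw [EvenHole.prepend, hm i (by omega), Nat.testBit_succ]
    congr 1
    cases b <;> simp; omega

theorem exists_hasMask (r : V → V → Bool) (v : V) :
    ∀ (n : ℕ) (c : ℕ → V), ∃ m < 2 ^ n, HasMask r n c v m
  | 0, _ => ⟨0, by simp, fun i hi => by omega⟩
  | n + 1, c => by
    obtain ⟨m, hm, h⟩ := exists_hasMask r v n fun i => c (i + 1)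
    refine ⟨2 * m + (r v (c 0)).toNat, ?_, ?_⟩
    · have := Bool.toNat_lt (r v (c 0)); rw [pow_succ]; omega
    · have := h.prepend (u := c 0) rfl
      convert this using 1
      funext i; cases i <;> rfl

/-- Soundness of the search: a pattern found among the coded vertices is present in the whole graph.
This direction yields the contradictions in a pattern-free `G`. -/
theorem occurs_of_finds {r : V → V → Bool} {g idx : List ℕ} {c : ℕ → V} (hc : IsCopy r g c)
    (hidx : ∀ i ∈ idx, i < g.length) : ∀ {cols : List (List Bool)} {Ms : List ℕ}
    {Ps : List (V → Prop)},
    List.Forall₂ (fun M P => ∀ i < g.length, M.testBit i = true → P (c i)) Ms Ps →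
      finds idx g cols Ms = true → Occurs r cols Ps
  | [], _, _, _, _ => by simp [Occurs]
  | _ :: _, _, _, .nil, _ => by simp [Occurs]
  | col :: cols, _, _, .cons hMP hMPs, h => by
    obtain ⟨i, hi, hM, h⟩ := (finds_cons_cons ..).1 h
    refine ⟨c i, hMP i (hidx i hi) hM, occurs_of_finds hc hidx (forall₂_zipWith ?_ col hMPs) h⟩
    intro b M P hP j hj hMj
    rw [testBit_restrict, Bool.and_eq_true, beq_iff_eq] at hMj
    refine ⟨hP j hj hMj.1, ?_⟩
    rw [hc i (hidx i hi) j hj, codeAdj, bitAt_eq_testBit, hMj.2]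

/-- Completeness of the search, which needs every vertex to be coded. This direction certifies that
the targets are pattern-free. -/
theorem finds_of_occurs {r : V → V → Bool} {g : List ℕ} {c : ℕ → V} (hc : IsCopy r g c)
    (surj : ∀ v, ∃ i < g.length, c i = v) : ∀ {cols : List (List Bool)} {Ms : List ℕ}
    {Ps : List (V → Prop)},
    List.Forall₂ (fun M P => ∀ i < g.length, P (c i) → M.testBit i = true) Ms Ps →
      Occurs r cols Ps → finds (List.range g.length) g cols Ms = true
  | [], _, _, _, _ => rfl
  | _ :: _, _, _, .nil, _ => rfl
  | col :: cols, _, _, .cons hMP hMPs, ⟨v, hv, h⟩ => by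
    obtain ⟨i, hi, rfl⟩ := surj v
    refine (finds_cons_cons ..).2 ⟨i, List.mem_range.2 hi, hMP i hi hv,
      finds_of_occurs hc surj (forall₂_zipWith ?_ col hMPs) h⟩
    intro b M P hP j hj hPj
    rw [testBit_restrict, Bool.and_eq_true, beq_iff_eq]
    refine ⟨hP j hj hPj.1, ?_⟩
    rw [← hPj.2, hc i hi j hj, codeAdj, bitAt_eq_testBit]

/-- A forbidden pattern with first vertex in position `0` occurs in the graph coded by `g`. -/
noncomputable def bad (g : List ℕ) : Bool :=
  cond (finds (List.range g.length) g squareCols (1 :: List.replicate 3 (2 ^ g.length - 1))) true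
    (cond (finds (List.range g.length) g pathsEndCols
      (1 :: List.replicate 5 (2 ^ g.length - 1))) true
    (cond (finds (List.range g.length) g pathsMidCols
      (1 :: List.replicate 5 (2 ^ g.length - 1))) true
    (finds (List.range g.length) g hexagonCols (1 :: List.replicate 5 (2 ^ g.length - 1)))))

/-- A forbidden pattern occurs in the graph coded by `g`. -/
noncomputable def badAnywhere (g : List ℕ) : Bool :=
  finds (List.range g.length) g squareCols (List.replicate 4 (2 ^ g.length - 1)) ||
    finds (List.range g.length) g pathsEndCols (List.replicate 6 (2 ^ g.length - 1)) ||
    finds (List.range g.length) g hexagonCols (List.replicate 6 (2 ^ g.length - 1))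

theorem IsCopy.bad_eq_false {r : V → V → Bool} (symm : ∀ u v, r u v = r v u)
    (free : PatternFree r) {g : List ℕ} {c : ℕ → V} (hc : IsCopy r g c) : bad g = false := by
  -- The candidate set `1` pins the first vertex to position `0`; `2 ^ g.length - 1` allows every
  -- position for the others.
  have key : ∀ cols, ¬ HasPattern r cols → ∀ k, cols.length = k + 1 →
      finds (List.range g.length) g cols (1 :: List.replicate k (2 ^ g.length - 1)) = false := by
    intro cols hcols k hk
    rw [Bool.eq_false_iff]
    refine fun h => hcols (occurs_of_finds hc (fun i => List.mem_range.1) ?_ h)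
    rw [hk]
    exact .cons (fun _ _ _ => trivial) (forall₂_replicate (fun _ _ _ => trivial) _)
  rw [bad, key _ free.1 3 rfl, key _ free.2.2 5 rfl, key _ free.2.1 5 rfl,
    key _ (fun h => free.2.2 (h.pathsEnd_of_pathsMid symm)) 5 rfl]
  rfl

theorem patternFree_of_badAnywhere {r : V → V → Bool} {g : List ℕ} {c : ℕ → V}
    (hc : IsCopy r g c) (surj : ∀ v, ∃ i < g.length, c i = v) (h : badAnywhere g = false) :
    PatternFree r := by
  have key : ∀ cols, HasPattern r cols → finds (List.range g.length) g cols
      (List.replicate cols.length (2 ^ g.length - 1)) = true := fun cols hcols =>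
    finds_of_occurs hc surj (forall₂_replicate
      (fun i hi _ => by rw [Nat.testBit_two_pow_sub_one]; exact decide_eq_true hi) _) hcols
  simp only [badAnywhere, Bool.or_eq_false_iff] at h
  exact ⟨fun hp => Bool.false_ne_true (h.1.1.symm.trans (key _ hp)),
    fun hp => Bool.false_ne_true (h.2.symm.trans (key _ hp)),
    fun hp => Bool.false_ne_true (h.1.2.symm.trans (key _ hp))⟩

end Codes

/-! ### Masks over a fixed induced copy: exclusion, elimination, recognition of a target -/

section Extraction

variable {V W : Type*}

/-- All entries of a list satisfy `p`. -/
noncomputable def allEntries (p : ℕ → Bool) (l : List ℕ) : Bool :=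
  List.rec true (fun a _ ih => cond (p a) ih false) l

theorem allEntries_iff {p : ℕ → Bool} :
    ∀ {l : List ℕ}, allEntries p l = true ↔ ∀ i ∈ l, p i = true
  | [] => by simp [allEntries]
  | a :: l => by
    change cond (p a) (allEntries p l) false = true ↔ _
    rw [List.forall_mem_cons, ← allEntries_iff (l := l)]
    cases p a <;> simp

/-- The graph obtained from the one coded by `g` by adding a vertex of mask `m` and then a vertex of
mask `k`, adjacent or not according to `b`, contains a forbidden pattern. -/
noncomputable def badPair (g : List ℕ) (m k : ℕ) (b : Bool) : Bool :=
  bad (addVertex (2 * k + b.toNat) (addVertex m g))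

/-- One bad value of `b` determines the adjacency of `u` and `v`; if both values are bad, the two
masks cannot both occur in `G`. -/
theorem closedAdj_ne_of_badPair {G : SimpleGraph V} (free : PatternFree (closedAdj G))
    {g : List ℕ} {c : ℕ → V} (hc : IsCopy (closedAdj G) g c) {u v : V} {m k : ℕ}
    (hu : HasMask (closedAdj G) g.length c u m) (hv : HasMask (closedAdj G) g.length c v k)
    {b : Bool} (hb : badPair g m k b = true) : closedAdj G v u ≠ b := by
  intro h
  have h₁ := hc.addVertex (closedAdj_self G) (closedAdj_comm G) hu
  have h₂ : HasMask (closedAdj G) (addVertex m g).length (prepend u c) v (2 * k + b.toNat) := by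
    rw [length_addVertex]; exact hv.prepend h
  have := (h₁.addVertex (closedAdj_self G) (closedAdj_comm G) h₂).bad_eq_false
    (closedAdj_comm G) free
  rw [badPair, this] at hb
  exact Bool.false_ne_true hb

/-- Every mask outside `types` produces a forbidden pattern. -/
noncomputable def typesCheck (g types : List ℕ) : Bool :=
  allEntries (fun m => cond (anyEntry (Nat.beq m) types) true (bad (addVertex m g)))
    (List.range (2 ^ g.length))

theorem exists_type {G : SimpleGraph V} (free : PatternFree (closedAdj G)) {g types : List ℕ}
    {c : ℕ → V} (hc : IsCopy (closedAdj G) g c) (h : typesCheck g types = true) (v : V) :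
    ∃ m ∈ types, HasMask (closedAdj G) g.length c v m := by
  obtain ⟨m, hm, hv⟩ := exists_hasMask (closedAdj G) v g.length c
  refine ⟨m, ?_, hv⟩
  have hb := (hc.addVertex (closedAdj_self G) (closedAdj_comm G) hv).bad_eq_false
    (closedAdj_comm G) free
  have := allEntries_iff.1 h m (List.mem_range.2 hm)
  simp only [hb, Bool.cond_true_left, Bool.or_false, anyEntry_iff, Nat.beq_eq] at this
  obtain ⟨i, hi, rfl⟩ := this
  exact hi

/-- In a graph without simplicial vertices, any nonempty set `D` contains a vertex with two
nonadjacent neighbours such that those of them in `D` see something that the vertex misses. -/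
theorem exists_nonadjacent_neighbors [Finite V] {G : SimpleGraph V}
    (hs : ∀ v, ¬ IsSimplicial G v) {D : Set V} (hD : D.Nonempty) :
    ∃ v ∈ D, ∃ a b, closedAdj G a v = true ∧ closedAdj G b v = true ∧ closedAdj G b a = false ∧
      (a ∈ D → ∃ w, closedAdj G w a = true ∧ closedAdj G w v = false) ∧
      (b ∈ D → ∃ w, closedAdj G w b = true ∧ closedAdj G w v = false) := by
  -- With `v` of least closed degree in `D`, a neighbour `a ∈ D` cannot have its closed
  -- neighbourhood inside that of `v`: the inclusion would be strict, because `b` sees `v` and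
  -- misses `a`.
  obtain ⟨v, hv, hmin⟩ := Set.exists_min_image D
    (fun v => {w | closedAdj G w v = true}.ncard) D.toFinite hD
  have key : ∀ a b, closedAdj G b v = true → closedAdj G b a = false → a ∈ D →
      ∃ w, closedAdj G w a = true ∧ closedAdj G w v = false := by
    intro a b hb hba ha
    by_contra! hcon
    refine (hmin a ha).not_gt (Set.ncard_lt_ncard ⟨fun w hw => ?_, fun hsub => ?_⟩ (Set.toFinite _))
    · exact eq_true_of_ne_false (hcon w hw)
    · exact Bool.false_ne_true (hba.symm.trans (hsub hb))
  have hns := hs v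
  simp only [IsSimplicial, SimpleGraph.IsClique, Set.Pairwise, SimpleGraph.mem_neighborSet,
    not_forall] at hns
  obtain ⟨a, ha, b, hb, hab, hnab⟩ := hns
  have h₁ : closedAdj G a v = true := closedAdj_iff.2 (.inr ha.symm)
  have h₂ : closedAdj G b v = true := closedAdj_iff.2 (.inr hb.symm)
  have h₃ : closedAdj G b a = false :=
    closedAdj_eq_false_iff.2 ⟨hab.symm, fun h => hnab h.symm⟩
  exact ⟨v, hv, a, b, h₁, h₂, h₃, key a b h₂ h₃, key b a h₁ (closedAdj_comm G a b ▸ h₃)⟩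

/-- The code `g` with a vertex of mask `d` and two nonadjacent neighbours of it, of masks `a` and
`b`. -/
noncomputable def cherry (g : List ℕ) (d a b : ℕ) : List ℕ :=
  addVertex (4 * b + 2) (addVertex (2 * a + 1) (addVertex d g))

/-- A vertex of mask `d` of minimal degree among such vertices must be simplicial. -/
noncomputable def eliminationCheck (g types : List ℕ) (d : ℕ) : Bool :=
  allEntries (fun a => cond (badPair g d a true) true
    (allEntries (fun b => cond (badPair g d b true) true (cond (bad (cherry g d a b)) true
      (cond (Nat.beq a d)
        (allEntries (fun k =>
          bad (addVertex (8 * k + 2) (cherry g d a b)) &&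
            bad (addVertex (8 * k + 3) (cherry g d a b))) types)
        (Nat.beq b d)))) types)) types

/-- Let `v` have mask `d` and least degree among such vertices, and let `a`, `b` be nonadjacent
neighbours of it. If `a` also has mask `d`, it sees some `w` that `v` misses, and every mask of `w`
gives a forbidden pattern. Otherwise the check forces `b` to have mask `d`, and the same argument
with `a` and `b` exchanged is contradictory. -/
theorem not_hasMask_of_eliminationCheck [Finite V] {G : SimpleGraph V}
    (free : PatternFree (closedAdj G)) (hs : ∀ v, ¬ IsSimplicial G v) {g types : List ℕ} {c : ℕ → V}
    (hc : IsCopy (closedAdj G) g c)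
    (htypes : ∀ v, ∃ m ∈ types, HasMask (closedAdj G) g.length c v m) {d : ℕ}
    (h : eliminationCheck g types d = true) (v : V) : ¬ HasMask (closedAdj G) g.length c v d := by
  intro hv
  have refl := closedAdj_self G
  have symm := closedAdj_comm G
  obtain ⟨v, hv, a, b, hav, hbv, hba, haD, hbD⟩ := exists_nonadjacent_neighbors hs
    (D := {v | HasMask (closedAdj G) g.length c v d}) ⟨v, hv⟩
  change HasMask (closedAdj G) g.length c v d at hv
  have hc₁ := hc.addVertex refl symm hv
  have main : ∀ a b, closedAdj G a v = true → closedAdj G b v = true → closedAdj G b a = false →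
      (HasMask (closedAdj G) g.length c a d →
        ∃ w, closedAdj G w a = true ∧ closedAdj G w v = false) →
      ∀ k ∈ types, HasMask (closedAdj G) g.length c a k →
      ∀ l ∈ types, HasMask (closedAdj G) g.length c b l → k ≠ d ∧ l = d := by
    intro a b hav hbv hba haD k hk hak l hl hbl
    have hak₁ : HasMask (closedAdj G) (addVertex d g).length (prepend v c) a (2 * k + 1) := by
      rw [length_addVertex]; exact hak.prepend hav
    have hc₂ := hc₁.addVertex refl symm hak₁
    have hbl₂ : HasMask (closedAdj G) (addVertex (2 * k + 1) (addVertex d g)).length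
        (prepend a (prepend v c)) b (4 * l + 2) := by
      rw [length_addVertex, length_addVertex]
      convert (hbl.prepend hbv).prepend hba using 1
      simp only [Bool.toNat_true, Bool.toNat_false]; omega
    have hc₃ := hc₂.addVertex refl symm hbl₂
    have h' := allEntries_iff.1 h k hk
    have nk : badPair g d k true = false := Bool.eq_false_iff.2 fun hb =>
      closedAdj_ne_of_badPair free hc hv hak hb hav
    have nl : badPair g d l true = false := Bool.eq_false_iff.2 fun hb =>
      closedAdj_ne_of_badPair free hc hv hbl hb hbv
    rw [nk, cond_false] at h'
    have h'' := allEntries_iff.1 h' l hl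
    rw [nl, cond_false, show bad (cherry g d k l) = false from hc₃.bad_eq_false symm free,
      cond_false] at h''
    by_cases hkd : k = d
    · subst hkd
      exfalso
      rw [show Nat.beq k k = true by rw [Nat.beq_eq], cond_true] at h''
      obtain ⟨w, hwa, hwv⟩ := haD hak
      obtain ⟨j, hj, hwj⟩ := htypes w
      have h₃ := allEntries_iff.1 h'' j hj
      rw [Bool.and_eq_true] at h₃
      have hw₃ : HasMask (closedAdj G) (cherry g k k l).length
          (prepend b (prepend a (prepend v c))) w (8 * j + 2 + (closedAdj G w b).toNat) := by
        rw [cherry, length_addVertex, length_addVertex, length_addVertex]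
        -- The three low bits of the mask of `w` record, from the lowest, `b` (either value), `a`
        -- (seen) and `v` (missed): hence `8 * j + 2` plus the bit for `b`.
        convert ((hwj.prepend hwv).prepend hwa).prepend rfl using 1
        simp only [Bool.toNat_true, Bool.toNat_false]; omega
      have hbad := (hc₃.addVertex refl symm hw₃).bad_eq_false symm free
      change bad (addVertex _ (cherry g k k l)) = false at hbad
      cases hwb : closedAdj G w b
      · rw [hwb] at hbad
        exact Bool.false_ne_true (hbad.symm.trans h₃.1)
      · rw [hwb] at hbad
        exact Bool.false_ne_true (hbad.symm.trans h₃.2)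
    · refine ⟨hkd, ?_⟩
      have : Nat.beq k d = false := by rwa [Bool.eq_false_iff, Ne, Nat.beq_eq]
      rw [this, cond_false, Nat.beq_eq] at h''
      exact h''
  obtain ⟨k, hk, hak⟩ := htypes a
  obtain ⟨l, hl, hbl⟩ := htypes b
  have h₁ := main a b hav hbv hba haD k hk hak l hl hbl
  have h₂ := main b a hbv hav (symm a b ▸ hba) hbD l hl hbl k hk hak
  exact h₂.1 h₁.2

/-- The masks given by the first rows of the code `t` determine adjacency as in `t`, are distinct,
and the graph coded by `g` is the initial part of `t`. -/
noncomputable def targetCheck (g t : List ℕ) : Bool :=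
  allEntries (fun i =>
    allEntries (fun j => badPair g (nthRow t i) (nthRow t j) (!codeAdj t j i) &&
      (Nat.beq i j ||
        anyEntry (fun q => Bool.xor (codeAdj t i q) (codeAdj t j q)) (List.range g.length)))
      (List.range t.length)) (List.range t.length) &&
  allEntries (fun i => allEntries (fun q => !Bool.xor (codeAdj g i q) (codeAdj t i q))
    (List.range g.length)) (List.range g.length)

/-- Closed adjacency of `G` is pulled back from `H` with a universal vertex `none` added, and all
vertices in `B` are in the range. -/
def IsBlowupOn (G : SimpleGraph V) (H : SimpleGraph W) (B : Set W) : Prop :=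
  ∃ φ : V → Option W, (∀ u v, closedAdj G u v = univClosedAdj H (φ u) (φ v)) ∧
    ∀ w ∈ B, ∃ v, φ v = some w

/-- Label each vertex by a row of `t` agreeing with its mask on the first `g.length` bits. The wrong
adjacency between two labels gives a forbidden pattern, so the labelling pulls back closed
adjacency. Distinct rows differ on those bits, so a mask determines its label, which gives the
surjectivity onto `B`. -/
theorem isBlowupOn_of_targetCheck {G : SimpleGraph V} {H : SimpleGraph W}
    (free : PatternFree (closedAdj G)) {g t : List ℕ} {c : ℕ → V} {e : ℕ → Option W}
    (hc : IsCopy (closedAdj G) g c) (he : IsCopy (univClosedAdj H) t e)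
    (h : targetCheck g t = true)
    (hmask : ∀ v, ∃ j < t.length, HasMask (closedAdj G) g.length c v (nthRow t j)) {B : Set W}
    (hB : ∀ w ∈ B, ∃ j < t.length, e j = some w ∧
      (g.length ≤ j → ∃ v, HasMask (closedAdj G) g.length c v (nthRow t j))) :
    IsBlowupOn G H B := by
  choose J hJ hJmask using hmask
  rw [targetCheck, Bool.and_eq_true] at h
  have hpair : ∀ i < t.length, ∀ j < t.length,
      badPair g (nthRow t i) (nthRow t j) (!codeAdj t j i) = true ∧
        (i = j ∨ ∃ q < g.length, codeAdj t i q ≠ codeAdj t j q) := by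
    intro i hi j hj
    have := allEntries_iff.1 (allEntries_iff.1 h.1 i (List.mem_range.2 hi)) j (List.mem_range.2 hj)
    simpa only [Bool.and_eq_true, Bool.or_eq_true, Nat.beq_eq, anyEntry_iff, List.mem_range,
      bne_iff_ne, Bool.xor] using this
  have hbase : ∀ i < g.length, ∀ q < g.length, codeAdj g i q = codeAdj t i q := by
    intro i hi q hq
    have := allEntries_iff.1 (allEntries_iff.1 h.2 i (List.mem_range.2 hi)) q (List.mem_range.2 hq)
    revert this
    cases codeAdj g i q <;> cases codeAdj t i q <;> simp
  have hadj : ∀ u v, closedAdj G u v = codeAdj t (J u) (J v) := by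
    intro u v
    have := closedAdj_ne_of_badPair free hc (hJmask v) (hJmask u)
      (hpair (J v) (hJ v) (J u) (hJ u)).1
    revert this
    cases closedAdj G u v <;> cases codeAdj t (J u) (J v) <;> simp
  refine ⟨fun v => e (J v), fun u v => ?_, fun w hw => ?_⟩
  · rw [hadj, he _ (hJ u) _ (hJ v)]
  · obtain ⟨j, hj, hjw, hv⟩ := hB w hw
    have : ∃ v, HasMask (closedAdj G) g.length c v (nthRow t j) := by
      rcases lt_or_ge j g.length with hjg | hjg
      -- A base vertex is represented by itself: its own row in `g` is its mask.
      · refine ⟨c j, fun q hq => ?_⟩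
        rw [hc j hjg q hq, hbase j hjg q hq, codeAdj, bitAt_eq_testBit]
      · exact hv hjg
    obtain ⟨v, hv⟩ := this
    refine ⟨v, ?_⟩
    rcases (hpair (J v) (hJ v) j hj).2 with heq | ⟨q, hq, hne⟩
    · exact (congrArg e heq).trans hjw
    · refine absurd ?_ hne
      rw [codeAdj, codeAdj, bitAt_eq_testBit, bitAt_eq_testBit, ← hJmask v q hq, ← hv q hq]

theorem HasMask.comp {r : V → V → Bool} {n : ℕ} {c : ℕ → V} {v : V} {m m' : ℕ}
    (hm : HasMask r n c v m) {σ : ℕ → ℕ} (hσ : ∀ i < n, σ i < n)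
    (h : ∀ i < n, bitAt m' i = bitAt m (σ i)) : HasMask r n (c ∘ σ) v m' := by
  intro i hi
  rw [← bitAt_eq_testBit, h i hi, bitAt_eq_testBit]
  exact hm _ (hσ i hi)

theorem IsCopy.comp {r : V → V → Bool} {g : List ℕ} {c : ℕ → V} (hc : IsCopy r g c) {σ : ℕ → ℕ}
    (hσ : ∀ i < g.length, σ i < g.length)
    (h : ∀ i < g.length, ∀ j < g.length, codeAdj g (σ i) (σ j) = codeAdj g i j) :
    IsCopy r g (c ∘ σ) := fun i hi j hj => by
  rw [← h i hi j hj]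
  exact hc _ (hσ i hi) _ (hσ j hj)

/-- Explore all subsets of a list (added to `ch`) without incompatible pairs. -/
def cover (compat : ℕ → ℕ → Bool) (leaf : List ℕ → Bool) : List ℕ → List ℕ → Bool
  | [], ch => leaf ch
  | i :: is, ch => cover compat leaf is ch &&
      (!ch.all (compat i) || cover compat leaf is (i :: ch))

/-- Follow the branch that selects exactly the indices satisfying `P`. It is never pruned, since
indices satisfying `P` are compatible, and its leaf collects all of them. -/
theorem exists_leaf_of_cover {compat : ℕ → ℕ → Bool} {leaf : List ℕ → Bool} {P : ℕ → Prop} :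
    ∀ {is ch : List ℕ}, (∀ i ∈ is, P i → ∀ j ∈ is ++ ch, P j → compat i j = true) →
      (∀ i ∈ ch, P i) → cover compat leaf is ch = true →
      ∃ l, leaf l = true ∧ (∀ i ∈ l, P i) ∧ ∀ i ∈ is ++ ch, P i → i ∈ l
  | [], ch, _, hch, h => ⟨ch, h, hch, fun _ hi _ => hi⟩
  | i :: is, ch, hcompat, hch, h => by
    rw [cover, Bool.and_eq_true, Bool.or_eq_true, Bool.not_eq_true'] at h
    by_cases hi : P i
    · have hall : ch.all (compat i) = true := List.all_eq_true.2 fun j hj =>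
        hcompat i (by simp) hi j (by simp [hj]) (hch j hj)
      obtain ⟨l, hl, hlP, hcov⟩ := exists_leaf_of_cover (is := is) (ch := i :: ch)
        (fun a ha hPa b hb => hcompat a (by simp [ha]) hPa b
          (by simp only [List.mem_append, List.mem_cons] at hb ⊢; tauto))
        (by simpa using ⟨hi, hch⟩) (h.2.resolve_left (by simp [hall]))
      exact ⟨l, hl, hlP, fun j hj => hcov j
        (by simp only [List.mem_append, List.mem_cons] at hj ⊢; tauto)⟩
    · obtain ⟨l, hl, hlP, hcov⟩ := exists_leaf_of_cover (is := is) (ch := ch)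
        (fun a ha hPa b hb => hcompat a (by simp [ha]) hPa b
          (by simp only [List.mem_append, List.mem_cons] at hb ⊢; tauto)) hch h.1
      refine ⟨l, hl, hlP, fun j hj hPj => hcov j ?_ hPj⟩
      have : j ≠ i := by rintro rfl; exact hi hPj
      simp only [List.mem_append, List.mem_cons] at hj ⊢
      tauto

end Extraction

/-! ### The target graphs, their codes and the finite checks on them -/

section Targets

variable {V W : Type*}

/-- A computable form of `univClosedAdj` for graphs given by lists of neighbours. -/
def univLater [DecidableEq W] (l : W → List W) : Option W → Option W → Bool
  | some u, some v => decide (u = v) || (l u).contains v || (l v).contains u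
  | _, _ => true

theorem univClosedAdj_fromRel [DecidableEq W] (l : W → List W) (u v : Option W) :
    univClosedAdj (SimpleGraph.fromRel fun a b => b ∈ l a) u v = univLater l u v := by
  cases u <;> cases v <;> simp only [univClosedAdj, univLater, closedAdj_fromRel]

/-- The sequence of vertices in the list `l`, followed by the universal vertex. -/
def enumeration (l : List W) (i : ℕ) : Option W := l[i]?

theorem exists_enumeration {l : List W} (hl : ∀ w, w ∈ l) {t : List ℕ}
    (ht : t.length = l.length + 1) (w : Option W) : ∃ i < t.length, enumeration l i = w := by
  cases w with
  | none => exact ⟨l.length, by omega, by simp [enumeration]⟩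
  | some w =>
    obtain ⟨i, hi, rfl⟩ := List.mem_iff_getElem.1 (hl w)
    exact ⟨i, by omega, by simp [enumeration, hi]⟩

theorem isCopy_enumeration [DecidableEq W] {later : W → List W} {l : List W} {t : List ℕ}
    (h : ∀ p < t.length, ∀ q < t.length,
      univLater later (enumeration l p) (enumeration l q) = (t.getD p 0).testBit q) :
    IsCopy (univClosedAdj (SimpleGraph.fromRel fun a b => b ∈ later a)) t (enumeration l) := by
  have key : ∀ (t : List ℕ) (p : ℕ), nthRow t p = t.getD p 0 := by
    intro t
    induction t with
    | nil => intro p; rfl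
    | cons a t ih =>
      intro p
      cases p with
      | zero => rfl
      | succ p => exact ih p
  intro p hp q hq
  rw [univClosedAdj_fromRel, h p hp q hq, codeAdj, bitAt_eq_testBit, key]

/-! Lists of all vertices of the target graphs. -/

def M0Vertex.list : List M0Vertex :=
  [.x 0, .x 1, .x 2, .x 3, .x 4, .x 5, .x 6, .y0, .y3, .z0, .z3, .z4]
def M1Vertex.list : List M1Vertex := [.x 0, .x 1, .x 2, .x 3, .x 4, .x 5, .x 6, .y0, .z2]
def M2Vertex.list : List M2Vertex := [.x 0, .x 1, .x 2, .x 3, .x 4, .x 5, .x 6, .y0, .z1, .z2]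
def M3Vertex.list : List M3Vertex := [.x 0, .x 1, .x 2, .x 3, .x 4, .x 5, .x 6, .y0, .z2, .z3]
def T0Vertex.list : List T0Vertex := [.a0, .a1, .b0, .b1, .b2, .b3, .c1, .c2, .c3]
def T1Vertex.list : List T1Vertex := [.a0, .a1, .b0, .b1, .b2, .b3, .c1, .c2, .c3, .f3]

theorem M0Vertex.mem_list (w : M0Vertex) : w ∈ M0Vertex.list := by
  rcases w with i | _ | _ | _ | _ | _
  · fin_cases i <;> decide
  all_goals decide

theorem M1Vertex.mem_list (w : M1Vertex) : w ∈ M1Vertex.list := by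
  rcases w with i | _ | _
  · fin_cases i <;> decide
  all_goals decide

theorem M2Vertex.mem_list (w : M2Vertex) : w ∈ M2Vertex.list := by
  rcases w with i | _ | _ | _
  · fin_cases i <;> decide
  all_goals decide

theorem M3Vertex.mem_list (w : M3Vertex) : w ∈ M3Vertex.list := by
  rcases w with i | _ | _ | _
  · fin_cases i <;> decide
  all_goals decide

theorem T0Vertex.mem_list (w : T0Vertex) : w ∈ T0Vertex.list := by cases w <;> decide

theorem T1Vertex.mem_list (w : T1Vertex) : w ∈ T1Vertex.list := by cases w <;> decide

/-- Closed adjacency rows of the seven-cycle. -/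
def codeC7 : List ℕ := [67, 7, 14, 28, 56, 112, 97]

/-- Closed adjacency rows of `T₀`. -/
def codeT0 : List ℕ := [55, 59, 69, 74, 147, 291, 460, 464, 480]

/-! Closed adjacency rows of the graphs with a universal vertex added. -/

def codeUnivM0 : List ℕ :=
  [8131, 6791, 4622, 5916, 8120, 7280, 7265, 8083, 8089, 8095, 8185, 8179, 8191]
def codeUnivM1 : List ℕ := [707, 647, 782, 796, 952, 880, 865, 659, 892, 1023]
def codeUnivM2 : List ℕ := [1219, 1415, 1806, 1820, 1976, 1904, 1633, 1427, 1982, 1916, 2047]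
def codeUnivM3 : List ℕ := [1731, 1159, 1294, 1820, 1976, 1904, 1889, 1683, 1916, 2041, 2047]
def codeUnivT0 : List ℕ := [567, 571, 581, 586, 659, 803, 972, 976, 992, 1023]
def codeUnivT1 : List ℕ := [1591, 1595, 1605, 1610, 1683, 1315, 1996, 2000, 1504, 1759, 2047]

theorem isCopy_M0 : IsCopy (univClosedAdj M0) codeUnivM0 (enumeration M0Vertex.list) :=
  isCopy_enumeration (by decide +kernel)

theorem isCopy_M1 : IsCopy (univClosedAdj M1) codeUnivM1 (enumeration M1Vertex.list) :=
  isCopy_enumeration (by decide +kernel)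

theorem isCopy_M2 : IsCopy (univClosedAdj M2) codeUnivM2 (enumeration M2Vertex.list) :=
  isCopy_enumeration (by decide +kernel)

theorem isCopy_M3 : IsCopy (univClosedAdj M3) codeUnivM3 (enumeration M3Vertex.list) :=
  isCopy_enumeration (by decide +kernel)

theorem isCopy_T0 : IsCopy (univClosedAdj T0) codeUnivT0 (enumeration T0Vertex.list) :=
  isCopy_enumeration (by decide +kernel)

theorem isCopy_T1 : IsCopy (univClosedAdj T1) codeUnivT1 (enumeration T1Vertex.list) :=
  isCopy_enumeration (by decide +kernel)

/-- This single check also serves every `M₀ ∖ S`, because pattern-freeness pulls back along maps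
that miss vertices. -/
theorem patternFree_M0 : PatternFree (univClosedAdj M0) :=
  patternFree_of_badAnywhere isCopy_M0 (exists_enumeration M0Vertex.mem_list rfl)
    (by decide +kernel)

theorem patternFree_M1 : PatternFree (univClosedAdj M1) :=
  patternFree_of_badAnywhere isCopy_M1 (exists_enumeration M1Vertex.mem_list rfl)
    (by decide +kernel)

theorem patternFree_M2 : PatternFree (univClosedAdj M2) :=
  patternFree_of_badAnywhere isCopy_M2 (exists_enumeration M2Vertex.mem_list rfl)
    (by decide +kernel)

theorem patternFree_M3 : PatternFree (univClosedAdj M3) :=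
  patternFree_of_badAnywhere isCopy_M3 (exists_enumeration M3Vertex.mem_list rfl)
    (by decide +kernel)

theorem patternFree_T0 : PatternFree (univClosedAdj T0) :=
  patternFree_of_badAnywhere isCopy_T0 (exists_enumeration T0Vertex.mem_list rfl)
    (by decide +kernel)

theorem patternFree_T1 : PatternFree (univClosedAdj T1) :=
  patternFree_of_badAnywhere isCopy_T1 (exists_enumeration T1Vertex.mem_list rfl)
    (by decide +kernel)

theorem targetCheck_M0 : targetCheck codeC7 codeUnivM0 = true := by decide +kernel
theorem targetCheck_M1 : targetCheck codeC7 codeUnivM1 = true := by decide +kernel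
theorem targetCheck_M2 : targetCheck codeC7 codeUnivM2 = true := by decide +kernel
theorem targetCheck_M3 : targetCheck codeC7 codeUnivM3 = true := by decide +kernel
theorem targetCheck_T0 : targetCheck codeT0 codeUnivT0 = true := by decide +kernel
theorem targetCheck_T1 : targetCheck codeT0 codeUnivT1 = true := by decide +kernel

/-- Masks over the seven-cycle: for each of the three kinds, the mask with centre `k` is in position
`k` of the corresponding block; the full mask comes last. -/
def masksC7 : List ℕ :=
  [67, 7, 14, 28, 56, 112, 97, 25, 50, 100, 73, 19, 38, 76, 103, 79, 31, 62, 124, 121, 115, 127]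

/-- Masks over `T₀`: twins, two further masks, and the full mask. -/
def masksT0 : List ℕ := [55, 59, 69, 74, 147, 291, 460, 464, 480, 223, 367, 511]

/-- Besides the masks admitted as labels up to symmetry, forbidden patterns leave at most the empty
mask and, over `T₀`, the mask 384, whose bits are `c₂` and `c₃`. The elimination of 384 comes after
that of 0 and uses its absence. -/
theorem typesCheck_C7 : typesCheck codeC7 (0 :: masksC7) = true := by decide +kernel
theorem typesCheck_T0 : typesCheck codeT0 (0 :: 384 :: masksT0) = true := by decide +kernel
theorem eliminationCheck_C7 : eliminationCheck codeC7 (0 :: masksC7) 0 = true := by decide +kernel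
theorem eliminationCheck_T0 : eliminationCheck codeT0 (0 :: 384 :: masksT0) 0 = true := by
  decide +kernel
theorem eliminationCheck_T0' : eliminationCheck codeT0 (384 :: masksT0) 384 = true := by
  decide +kernel

end Targets

/-! ### From an induced C₇ or T₀ to a blowup of a target -/

section Labellings

variable {V W : Type*}

/-- Here `hi` lists the indices of masks that may occur and `lo` those that must; `k` bounds the
positions of `t` that have to be attained. -/
theorem isBlowupOn_of_labelling {G : SimpleGraph V} {H : SimpleGraph W}
    (free : PatternFree (closedAdj G)) {g t masks lo hi : List ℕ} {c : ℕ → V} {e : ℕ → Option W}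
    (hc : IsCopy (closedAdj G) g c)
    (Hhi : ∀ v, ∃ h ∈ hi, HasMask (closedAdj G) g.length c v (masks.getD h 0))
    (Hlo : ∀ h ∈ lo, ∃ v, HasMask (closedAdj G) g.length c v (masks.getD h 0))
    (he : IsCopy (univClosedAdj H) t e) (h : targetCheck g t = true)
    (hhi : ∀ h ∈ hi, ∃ j < t.length, ∀ q < g.length,
      bitAt (nthRow t j) q = bitAt (masks.getD h 0) q)
    {k : ℕ} (hk : k ≤ t.length)
    (hlo : ∀ j < k, g.length ≤ j → ∃ h ∈ lo, ∀ q < g.length,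
      bitAt (nthRow t j) q = bitAt (masks.getD h 0) q)
    {B : Set W} (hB : ∀ w ∈ B, ∃ j < k, e j = some w) : IsBlowupOn G H B := by
  have conv : ∀ {v m m'}, HasMask (closedAdj G) g.length c v m →
      (∀ q < g.length, bitAt m' q = bitAt m q) → HasMask (closedAdj G) g.length c v m' :=
    fun hv hm => hv.comp (σ := id) (fun _ => id) hm
  refine isBlowupOn_of_targetCheck free hc he h (fun v => ?_) fun w hw => ?_
  · obtain ⟨i, hi, hv⟩ := Hhi v
    obtain ⟨j, hj, hjq⟩ := hhi i hi
    exact ⟨j, hj, conv hv hjq⟩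
  · obtain ⟨j, hj, hjw⟩ := hB w hw
    refine ⟨j, hj.trans_le hk, hjw, fun hgj => ?_⟩
    obtain ⟨i, hi, hiq⟩ := hlo j hj hgj
    obtain ⟨v, hv⟩ := Hlo i hi
    exact ⟨v, conv hv hiq⟩

theorem exists_mask_of_eliminationCheck {G : SimpleGraph V} {g types : List ℕ} {c : ℕ → V} {d : ℕ}
    (htypes : ∀ v, ∃ m ∈ d :: types, HasMask (closedAdj G) g.length c v m)
    (hd : ∀ v, ¬ HasMask (closedAdj G) g.length c v d) (v : V) :
    ∃ m ∈ types, HasMask (closedAdj G) g.length c v m := by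
  obtain ⟨m, hm, hv⟩ := htypes v
  rcases List.mem_cons.1 hm with rfl | hm
  · exact absurd hv (hd v)
  · exact ⟨m, hm, hv⟩

theorem exists_index {G : SimpleGraph V} {n : ℕ} {masks : List ℕ} {c : ℕ → V}
    (h : ∀ v, ∃ m ∈ masks, HasMask (closedAdj G) n c v m) (v : V) :
    ∃ i < masks.length, HasMask (closedAdj G) n c v (masks.getD i 0) := by
  obtain ⟨m, hm, hv⟩ := h v
  obtain ⟨i, hi, rfl⟩ := List.mem_iff_getElem.1 hm
  exact ⟨i, hi, by rwa [List.getD_eq_getElem _ _ hi]⟩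

/-- The dihedral action `k ↦ s + e * k` on the centres of the masks in `masksC7`. -/
def dihedralAct (s e i : ℕ) : ℕ := if i < 21 then 7 * (i / 7) + (s + e * (i % 7)) % 7 else i

/-- Compatibility of masks over the seven-cycle that are neither twins nor full. -/
def compatC7 (i j : ℕ) : Bool :=
  if i < 14 then
    if j < 14 then [0, 3, 4].contains ((j + 21 - i) % 7)
    else !([3, 4].contains ((j + 21 - i) % 7))
  else if j < 14 then !([3, 4].contains ((j + 21 - i) % 7))
  else !([2, 5].contains ((j + 21 - i) % 7))

/-- For `M₀`, `M₁`, `M₂`, `M₃`: the masks that must be present, and those that may be. -/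
def targetsC7 : List (List ℕ × List ℕ) :=
  [([], [0, 1, 2, 3, 4, 5, 6, 11, 7, 16, 19, 20, 21]),
    ([11, 18], [0, 1, 2, 3, 4, 5, 6, 11, 18, 21]),
    ([11, 17, 18], [0, 1, 2, 3, 4, 5, 6, 11, 17, 18, 21]),
    ([11, 18, 19], [0, 1, 2, 3, 4, 5, 6, 11, 18, 19, 21])]

/-- Up to the dihedral action, the masks in `l` fit one of the targets. -/
def leafC7 (l : List ℕ) : Bool :=
  (List.range 7).any fun s => [1, 6].any fun e => targetsC7.any fun t =>
    (l ++ [0, 1, 2, 3, 4, 5, 6, 21]).all (fun i => t.2.any fun h => dihedralAct s e h == i) &&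
      t.1.all fun h => l.contains (dihedralAct s e h)

/-- Pairwise compatibility suffices: each compatible set of masks of the second and third kinds fits
one of the four targets, up to the dihedral action. -/
theorem cover_C7 :
    cover compatC7 leafC7 [7, 8, 9, 10, 11, 12, 13, 14, 15, 16, 17, 18, 19, 20] [] = true := by
  decide +kernel

theorem compatCheck_C7 : ∀ i ∈ [7, 8, 9, 10, 11, 12, 13, 14, 15, 16, 17, 18, 19, 20],
    ∀ j ∈ [7, 8, 9, 10, 11, 12, 13, 14, 15, 16, 17, 18, 19, 20], (compatC7 i j ||
      (badPair codeC7 (masksC7.getD i 0) (masksC7.getD j 0) true &&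
        badPair codeC7 (masksC7.getD i 0) (masksC7.getD j 0) false)) = true := by
  decide +kernel

/-- The value `e = 1` gives the rotations and `e = 6`, that is `-1` modulo 7, the reflections; both
permute the masks along with the cycle. -/
theorem dihedral_C7 : ∀ s < 7, ∀ e ∈ [1, 6], ∀ i < 7, dihedralAct s e i < 7 ∧
    (∀ j < 7, codeAdj codeC7 (dihedralAct s e i) (dihedralAct s e j) = codeAdj codeC7 i j) ∧
    ∀ h < 22, bitAt (masksC7.getD h 0) i =
      bitAt (masksC7.getD (dihedralAct s e h) 0) (dihedralAct s e i) := by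
  decide +kernel

theorem bound_targetsC7 : ∀ t ∈ targetsC7, (∀ h ∈ t.1, h < 22) ∧ ∀ h ∈ t.2, h < 22 := by
  decide

theorem exists_labelling_C7 [Finite V] {G : SimpleGraph V} (free : PatternFree (closedAdj G))
    (hs : ∀ v, ¬ IsSimplicial G v) {c : ℕ → V} (hc : IsCopy (closedAdj G) codeC7 c) :
    ∃ c', IsCopy (closedAdj G) codeC7 c' ∧ ∃ t ∈ targetsC7,
      (∀ v, ∃ h ∈ t.2, HasMask (closedAdj G) codeC7.length c' v (masksC7.getD h 0)) ∧
      ∀ h ∈ t.1, ∃ v, HasMask (closedAdj G) codeC7.length c' v (masksC7.getD h 0) := by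
  have h₀ := exists_type free hc typesCheck_C7
  have hidx := exists_index (exists_mask_of_eliminationCheck h₀
    (not_hasMask_of_eliminationCheck free hs hc h₀ eliminationCheck_C7))
  obtain ⟨l, hl, hlP, hcov⟩ := exists_leaf_of_cover (compat := compatC7) (leaf := leafC7)
    (P := fun i => ∃ v, HasMask (closedAdj G) codeC7.length c v (masksC7.getD i 0))
    (fun i hi ⟨u, hu⟩ j hj ⟨v, hv⟩ => by
      rw [List.append_nil] at hj
      have h := compatCheck_C7 i hi j hj
      rw [Bool.or_eq_true, Bool.and_eq_true] at h
      refine h.resolve_right fun hb => ?_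
      have h₁ := closedAdj_ne_of_badPair free hc hu hv hb.1
      have h₂ := closedAdj_ne_of_badPair free hc hu hv hb.2
      revert h₁ h₂
      cases closedAdj G v u <;> simp)
    (by simp) cover_C7
  simp only [leafC7, List.any_eq_true, Bool.and_eq_true, List.all_eq_true, List.mem_range,
    beq_iff_eq, List.contains_iff_mem] at hl
  obtain ⟨s, hs7, e, he, t, ht, hhi, hlo⟩ := hl
  have hD := dihedral_C7 s hs7 e he
  have hlt : ∀ i < 7, dihedralAct s e i < 7 := fun i hi => (hD i hi).1
  have hmask : ∀ {v h}, h < 22 →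
      HasMask (closedAdj G) codeC7.length c v (masksC7.getD (dihedralAct s e h) 0) →
      HasMask (closedAdj G) codeC7.length (c ∘ dihedralAct s e) v (masksC7.getD h 0) :=
    fun {v h} hh hv => hv.comp hlt fun i hi => (hD i hi).2.2 h hh
  refine ⟨c ∘ dihedralAct s e, hc.comp hlt fun i hi j hj => (hD i hi).2.1 j hj, t, ht,
    fun v => ?_, fun h hh => ?_⟩
  · obtain ⟨i, hi, hv⟩ := hidx v
    -- Indices 0 to 6 are twins of cycle vertices and 21 is the full mask; these are absent from the
    -- branching and allowed in every target.
    have hmem : i ∈ l ++ [0, 1, 2, 3, 4, 5, 6, 21] := by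
      by_cases h : i ∈ [7, 8, 9, 10, 11, 12, 13, 14, 15, 16, 17, 18, 19, 20]
      · exact List.mem_append_left _ (hcov i (by simpa using h) ⟨v, hv⟩)
      · refine List.mem_append_right _ ?_
        change i < 22 at hi
        revert h
        interval_cases i <;> decide
    obtain ⟨h, hh, rfl⟩ := hhi i hmem
    exact ⟨h, hh, hmask ((bound_targetsC7 t ht).2 h hh) hv⟩
  · obtain ⟨v, hv⟩ := hlP _ (hlo h hh)
    exact ⟨v, hmask ((bound_targetsC7 t ht).1 h hh) hv⟩

theorem exists_enumeration_some {l : List W} (hl : ∀ w, w ∈ l) (w : W) :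
    ∃ i < l.length, enumeration l i = some w := by
  obtain ⟨i, hi, rfl⟩ := List.mem_iff_getElem.1 (hl w)
  exact ⟨i, hi, by simp [enumeration, hi]⟩

theorem isBlowupOn_of_isCopy_C7 [Finite V] {G : SimpleGraph V} (free : PatternFree (closedAdj G))
    (hs : ∀ v, ¬ IsSimplicial G v) {c : ℕ → V} (hc : IsCopy (closedAdj G) codeC7 c) :
    IsBlowupOn G M0 (Set.range M0Vertex.x) ∨ IsBlowupOn G M1 Set.univ ∨
      IsBlowupOn G M2 Set.univ ∨ IsBlowupOn G M3 Set.univ := by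
  obtain ⟨c', hc', t, ht, hhi, hlo⟩ := exists_labelling_C7 free hs hc
  simp only [targetsC7, List.mem_cons, List.not_mem_nil, or_false] at ht
  rcases ht with rfl | rfl | rfl | rfl
  -- Only the seven cycle vertices must be attained: any other vertex of `M₀` may be missing, which
  -- accounts for the graphs `M₀ ∖ S`.
  · refine .inl (isBlowupOn_of_labelling (k := 7) free hc' hhi hlo isCopy_M0 targetCheck_M0
      (by decide +kernel) (by decide) (by decide +kernel) ?_)
    rintro _ ⟨i, rfl⟩
    exact ⟨i, i.isLt, by fin_cases i <;> rfl⟩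
  · exact .inr (.inl (isBlowupOn_of_labelling free hc' hhi hlo isCopy_M1 targetCheck_M1
      (by decide +kernel) (by decide) (by decide +kernel)
      fun w _ => exists_enumeration_some M1Vertex.mem_list w))
  · exact .inr (.inr (.inl (isBlowupOn_of_labelling free hc' hhi hlo isCopy_M2 targetCheck_M2
      (by decide +kernel) (by decide) (by decide +kernel)
      fun w _ => exists_enumeration_some M2Vertex.mem_list w)))
  · exact .inr (.inr (.inr (isBlowupOn_of_labelling free hc' hhi hlo isCopy_M3 targetCheck_M3
      (by decide +kernel) (by decide) (by decide +kernel)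
      fun w _ => exists_enumeration_some M3Vertex.mem_list w)))

/-- The automorphism of `T₀` exchanging `b₂` with `b₃` and `c₂` with `c₃`. -/
def swapT0 (i : ℕ) : ℕ := [0, 1, 2, 3, 5, 4, 6, 8, 7].getD i 0

theorem swap_T0 : ∀ i < 9, swapT0 i < 9 ∧
    (∀ j < 9, codeAdj codeT0 (swapT0 i) (swapT0 j) = codeAdj codeT0 i j) := by
  decide +kernel

theorem swap_masksT0 : ∀ h < 12, h ≠ 9 → ∃ k ∈ List.range 12, k ≠ 10 ∧ ∀ i < 9,
    bitAt (masksT0.getD k 0) i = bitAt (masksT0.getD h 0) (swapT0 i) := by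
  decide +kernel

/-- Mask 9 is that of `f₃`, and mask 10 is its mirror image under `swapT0`. They cannot coexist, so
after a possible swap mask 10 does not occur; the target is then `T₁` or `T₀` according to whether
mask 9 occurs. -/
theorem isBlowupOn_of_isCopy_T0 [Finite V] {G : SimpleGraph V} (free : PatternFree (closedAdj G))
    (hs : ∀ v, ¬ IsSimplicial G v) {c : ℕ → V} (hc : IsCopy (closedAdj G) codeT0 c) :
    IsBlowupOn G T0 Set.univ ∨ IsBlowupOn G T1 Set.univ := by
  have h₀ := exists_type free hc typesCheck_T0
  have h₁ := exists_mask_of_eliminationCheck h₀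
    (not_hasMask_of_eliminationCheck free hs hc h₀ eliminationCheck_T0)
  have hidx := exists_index (exists_mask_of_eliminationCheck h₁
    (not_hasMask_of_eliminationCheck free hs hc h₁ eliminationCheck_T0'))
  have main : ∀ c : ℕ → V, IsCopy (closedAdj G) codeT0 c →
      (∀ v, ∃ i < 12, i ≠ 10 ∧ HasMask (closedAdj G) codeT0.length c v (masksT0.getD i 0)) →
      IsBlowupOn G T0 Set.univ ∨ IsBlowupOn G T1 Set.univ := by
    intro c hc hidx
    by_cases h9 : ∃ v, HasMask (closedAdj G) codeT0.length c v (masksT0.getD 9 0)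
    · refine .inr (isBlowupOn_of_labelling (masks := masksT0) (lo := [9])
        (hi := [0, 1, 2, 3, 4, 5, 6, 7, 8, 9, 11]) free hc ?_ (by simpa using h9)
        isCopy_T1 targetCheck_T1 (by decide +kernel) (by decide) (by decide +kernel)
        fun w _ => exists_enumeration_some T1Vertex.mem_list w)
      intro v
      obtain ⟨i, hi, hi', hv⟩ := hidx v
      exact ⟨i, by interval_cases i <;> simp at hi' ⊢, hv⟩
    · refine .inl (isBlowupOn_of_labelling (masks := masksT0) (lo := [])
        (hi := [0, 1, 2, 3, 4, 5, 6, 7, 8, 11]) free hc ?_ (by simp)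
        isCopy_T0 targetCheck_T0 (by decide +kernel) (by decide) (by decide +kernel)
        fun w _ => exists_enumeration_some T0Vertex.mem_list w)
      intro v
      obtain ⟨i, hi, hi', hv⟩ := hidx v
      have hi9 : i ≠ 9 := by rintro rfl; exact h9 ⟨v, hv⟩
      exact ⟨i, by interval_cases i <;> simp at hi' hi9 ⊢, hv⟩
  by_cases h10 : ∃ v, HasMask (closedAdj G) codeT0.length c v (masksT0.getD 10 0)
  · obtain ⟨u, hu⟩ := h10
    have h9 : ∀ v, ¬ HasMask (closedAdj G) codeT0.length c v (masksT0.getD 9 0) := by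
      intro v hv
      have h₁ := closedAdj_ne_of_badPair free hc hu hv (b := true) (by decide +kernel)
      have h₂ := closedAdj_ne_of_badPair free hc hu hv (b := false) (by decide +kernel)
      revert h₁ h₂
      cases closedAdj G v u <;> simp
    refine main (c ∘ swapT0) (hc.comp (fun i hi => (swap_T0 i hi).1)
      fun i hi j hj => (swap_T0 i hi).2 j hj) fun v => ?_
    obtain ⟨i, hi, hv⟩ := hidx v
    obtain ⟨k, hk, hk', hki⟩ := swap_masksT0 i hi (by rintro rfl; exact h9 v hv)
    exact ⟨k, List.mem_range.1 hk, hk', hv.comp (fun i hi => (swap_T0 i hi).1) hki⟩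
  · refine main c hc fun v => ?_
    obtain ⟨i, hi, hv⟩ := hidx v
    exact ⟨i, hi, by rintro rfl; exact h10 ⟨v, hv⟩, hv⟩

end Labellings

/-! ### Blowups as thickenings with universal vertices -/

section Universal

variable {V W U : Type*}

/-- The fibre over `none` consists of universal vertices, and the other fibres are the parts.
Reflexivity of closed adjacency makes each part a clique. The map `ι` identifies `K` with the
subgraph of `H` that `φ` attains. -/
theorem IsBlowupOn.exists_thickening {G : SimpleGraph V} {H : SimpleGraph W} {K : SimpleGraph U}
    {φ : V → Option W} (hφ : ∀ u v, closedAdj G u v = univClosedAdj H (φ u) (φ v)) {ι : U → W}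
    (inj : Function.Injective ι) (hK : ∀ a b, closedAdj K a b = closedAdj H (ι a) (ι b))
    (hsub : ∀ v w, φ v = some w → ∃ a, ι a = w) (hsurj : ∀ a, ∃ v, φ v = some (ι a)) :
    ∃ S : Set V, ObtainedByAddingUniversal G S ∧ IsThickening (G.induce S) K := by
  have huniv : ∀ u v, φ u = none → u ≠ v → G.Adj u v := fun u v hu huv => by
    have := hφ u v
    rw [hu, univClosedAdj.eq_2 _ _ _ (by simp)] at this
    exact (closedAdj_iff.1 this).resolve_left huv
  refine ⟨{v | φ v ≠ none}, ⟨fun u hu v _ huv => huniv u v (by simpa using hu) huv,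
    fun u hu v hv => huniv u v (by simpa using hu) ?_⟩, fun a => {v | φ v.1 = some (ι a)},
    fun a => ?_, fun a b hab => ?_, ?_, fun a u hu v hv huv => ?_, fun a b hab hadj u hu v hv => ?_,
    fun a b hab hadj u hu v hv => ?_⟩
  · rintro rfl; exact hu hv
  · obtain ⟨v, hv⟩ := hsurj a
    exact ⟨⟨v, by simp [hv]⟩, hv⟩
  · rw [Set.disjoint_left]
    intro v hva hvb
    exact hab (inj (Option.some.inj (hva.symm.trans hvb)))
  · refine Set.eq_univ_of_forall fun ⟨v, hv⟩ => ?_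
    obtain ⟨w, hw⟩ := Option.ne_none_iff_exists'.1 hv
    obtain ⟨a, rfl⟩ := hsub v w hw
    exact Set.mem_iUnion.2 ⟨a, hw⟩
  · have := hφ u.1 v.1
    rw [show φ u.1 = _ from hu, show φ v.1 = _ from hv, univClosedAdj, closedAdj_self] at this
    exact (closedAdj_iff.1 this).resolve_left fun h => huv (Subtype.ext h)
  · have := hφ u.1 v.1
    rw [show φ u.1 = _ from hu, show φ v.1 = _ from hv, univClosedAdj, ← hK,
      closedAdj_iff.2 (.inr hadj)] at this
    refine (closedAdj_iff.1 this).resolve_left fun h => hab ?_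
    have hv' : φ v.1 = some (ι b) := hv
    rw [← h, show φ u.1 = _ from hu] at hv'
    exact inj (Option.some.inj hv')
  · have := hφ u.1 v.1
    rw [show φ u.1 = _ from hu, show φ v.1 = _ from hv, univClosedAdj, ← hK,
      closedAdj_eq_false_iff.2 ⟨hab, hadj⟩] at this
    exact (closedAdj_eq_false_iff.1 this).2

theorem isBlowupOn_of_thickening {G : SimpleGraph V} {K : SimpleGraph U} {S : Set V}
    (hS : ObtainedByAddingUniversal G S) (h : IsThickening (G.induce S) K) :
    IsBlowupOn G K Set.univ := by
  classical
  obtain ⟨X, hne, hdisj, hcover, hclique, hcomp, hanti⟩ := h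
  have hX : ∀ v : S, ∃ a, v ∈ X a := fun v =>
    Set.mem_iUnion.1 (hcover ▸ Set.mem_univ v)
  choose f hf using hX
  have huniv : ∀ u v, u ∉ S → closedAdj G u v = true := by
    intro u v hu
    rw [closedAdj_iff]
    by_cases huv : u = v
    · exact .inl huv
    · by_cases hv : v ∈ S
      · exact .inr (hS.2 u hu v hv)
      · exact .inr (hS.1 hu hv huv)
  refine ⟨fun v => if hv : v ∈ S then some (f ⟨v, hv⟩) else none, fun u v => ?_, fun a _ => ?_⟩
  · by_cases hu : u ∈ S
    · by_cases hv : v ∈ S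
      · simp only [hu, hv, dif_pos, univClosedAdj]
        by_cases hab : f ⟨u, hu⟩ = f ⟨v, hv⟩
        · rw [hab, closedAdj_self, closedAdj_iff]
          by_cases huv : u = v
          · exact .inl huv
          · have := hclique _ (hf ⟨u, hu⟩) (hab ▸ hf ⟨v, hv⟩) fun h =>
              huv (congrArg Subtype.val h)
            exact .inr this
        · by_cases hadj : K.Adj (f ⟨u, hu⟩) (f ⟨v, hv⟩)
          · rw [closedAdj_iff.2 (.inr hadj), closedAdj_iff]
            exact .inr (hcomp _ _ hab hadj _ (hf ⟨u, hu⟩) _ (hf ⟨v, hv⟩))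
          · rw [closedAdj_eq_false_iff.2 ⟨hab, hadj⟩, closedAdj_eq_false_iff]
            refine ⟨?_, hanti _ _ hab hadj _ (hf ⟨u, hu⟩) _ (hf ⟨v, hv⟩)⟩
            rintro rfl
            exact hab rfl
      · rw [closedAdj_comm, huniv v u hv]
        simp [hv, univClosedAdj]
    · rw [huniv u v hu]
      simp [hu, univClosedAdj]
  · obtain ⟨v, hv⟩ := hne a
    refine ⟨v.1, ?_⟩
    simp only [v.2, dif_pos]
    by_contra hcon
    exact Set.disjoint_left.1 (hdisj _ _ fun h => hcon (congrArg some h)) (hf v) hv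

theorem IsBlowupOn.isIndContained {G : SimpleGraph V} {H : SimpleGraph W} {B : Set W}
    (h : IsBlowupOn G H B) {F : SimpleGraph U} {ι : U → W} (hι : ∀ a, ι a ∈ B)
    (hF : ∀ a b, closedAdj H (ι a) (ι b) = closedAdj F a b)
    (twins : ∀ a b, (∀ c, closedAdj F a c = closedAdj F b c) → a = b) :
    SimpleGraph.IsIndContained F G := by
  obtain ⟨φ, hφ, hB⟩ := h
  choose f hf using fun a => hB (ι a) (hι a)
  exact isIndContained_of_closedAdj f
    (fun a b => by rw [hφ, hf, hf, univClosedAdj, hF]) twins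

theorem IsBlowupOn.not_isSimplicial {G : SimpleGraph V} {H : SimpleGraph W} {B : Set W}
    (h : IsBlowupOn G H B) (hB : ∀ w : Option W, ∃ a ∈ B, ∃ b ∈ B,
      univClosedAdj H w (some a) = true ∧ univClosedAdj H w (some b) = true ∧
        univClosedAdj H (some a) (some b) = false) (v : V) : ¬ IsSimplicial G v := by
  obtain ⟨φ, hφ, hB'⟩ := h
  intro hs
  obtain ⟨a, ha, b, hb, hva, hvb, hab⟩ := hB (φ v)
  obtain ⟨x, hx⟩ := hB' a ha
  obtain ⟨y, hy⟩ := hB' b hb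
  rw [← hx, ← hφ] at hva
  rw [← hy, ← hφ] at hvb
  rw [← hx, ← hy, ← hφ] at hab
  -- Closed adjacency to `x` might be equality, but `v = x` would make `x` see `y`.
  have hvx : v ≠ x := by rintro rfl; rw [hvb] at hab; simp at hab
  have hvy : v ≠ y := by rintro rfl; rw [closedAdj_comm, hva] at hab; simp at hab
  have hxy := closedAdj_eq_false_iff.1 hab
  exact hxy.2 (hs ((closedAdj_iff.1 hva).resolve_left hvx)
    ((closedAdj_iff.1 hvb).resolve_left hvy) hxy.1)

end Universal

/-! ### Anticomponents and universal vertices -/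

section Anticomponents

variable {V W U : Type*}

/-- Distinct nonadjacent vertices have anticomplete parts, so walks in the complement of `K` lift to
the complement of `G`. -/
theorem IsThickening.anticonnected {G : SimpleGraph V} {K : SimpleGraph U}
    (h : IsThickening G K) (hK : Anticonnected K) [Nontrivial U] : Anticonnected G := by
  obtain ⟨X, hne, hdisj, hcover, -, -, hanti⟩ := h
  have step : ∀ a b, Kᶜ.Adj a b → ∀ u ∈ X a, ∀ v ∈ X b, Gᶜ.Adj u v := by
    intro a b hab u hu v hv
    rw [SimpleGraph.compl_adj] at hab ⊢
    refine ⟨?_, hanti a b hab.1 hab.2 u hu v hv⟩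
    rintro rfl
    exact Set.disjoint_left.1 (hdisj a b hab.1) hu hv
  have walk : ∀ a b, Kᶜ.Walk a b → ∀ u ∈ X a, ∀ v ∈ X b, a ≠ b → Gᶜ.Reachable u v := by
    intro a b p
    induction p with
    | nil => exact fun u _ v _ h => absurd rfl h
    | @cons a b c hab p ih =>
      intro u hu v hv _
      by_cases hbc : b = c
      · subst hbc
        exact (step a b hab u hu v hv).reachable
      · obtain ⟨w, hw⟩ := hne b
        exact (step a b hab u hu w hw).reachable.trans (ih w hw v hv hbc)
  have hX : ∀ v, ∃ a, v ∈ X a := fun v => Set.mem_iUnion.1 (hcover ▸ Set.mem_univ v)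
  have reach : ∀ a b u v, u ∈ X a → v ∈ X b → a ≠ b → Gᶜ.Reachable u v :=
    fun a b u v hu hv hab => (hK.preconnected a b).elim fun p => walk a b p u hu v hv hab
  obtain ⟨a₀⟩ := hK.nonempty
  obtain ⟨v₀, -⟩ := hne a₀
  refine (SimpleGraph.connected_iff _).2 ⟨fun u v => ?_, ⟨v₀⟩⟩
  obtain ⟨a, ha⟩ := hX u
  obtain ⟨b, hb⟩ := hX v
  by_cases hab : a = b
  -- Two vertices of one part are adjacent in `G`, so they are linked through a vertex of another
  -- part.
  · obtain ⟨c, hc⟩ := exists_ne a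
    obtain ⟨w, hw⟩ := hne c
    exact (reach a c u w ha hw hc.symm).trans (reach c b w v hw hb (hab ▸ hc))
  · exact reach a b u v ha hb hab

theorem IsThickening.nontrivial {G : SimpleGraph V} {K : SimpleGraph U} (h : IsThickening G K)
    [Nontrivial U] : Nontrivial V := by
  obtain ⟨X, hne, hdisj, -⟩ := h
  obtain ⟨a, b, hab⟩ := exists_pair_ne U
  obtain ⟨u, hu⟩ := hne a
  obtain ⟨v, hv⟩ := hne b
  refine ⟨u, v, ?_⟩
  rintro rfl
  exact Set.disjoint_left.1 (hdisj a b hab) hu hv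

theorem anticonnected_of_chain {K : SimpleGraph U} (x₀ : U)
    (h : ∀ w, ∃ j k, closedAdj K x₀ j = false ∧ closedAdj K j k = false ∧
      closedAdj K k w = false) : Anticonnected K ∧ Nontrivial U := by
  have adj : ∀ {a b}, closedAdj K a b = false → Kᶜ.Reachable a b := fun hab =>
    SimpleGraph.Adj.reachable ((SimpleGraph.compl_adj ..).2 (closedAdj_eq_false_iff.1 hab))
  have hr : ∀ w, Kᶜ.Reachable x₀ w := fun w => by
    obtain ⟨j, k, h₁, h₂, h₃⟩ := h w
    exact (adj h₁).trans ((adj h₂).trans (adj h₃))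
  obtain ⟨j, -, h₁, -⟩ := h x₀
  exact ⟨(SimpleGraph.connected_iff _).2 ⟨fun u v => (hr u).symm.trans (hr v), ⟨x₀⟩⟩,
    ⟨x₀, j, (closedAdj_eq_false_iff.1 h₁).1⟩⟩

theorem exists_not_adj_of_anticonnected {G : SimpleGraph V} {T : Set V}
    (hT : Anticonnected (G.induce T)) (hnt : T.Nontrivial) {u : V} (hu : u ∈ T) :
    ∃ v, v ≠ u ∧ ¬ G.Adj u v := by
  obtain ⟨w, hw, hwu⟩ := hnt.exists_ne u
  obtain ⟨p⟩ := hT.preconnected ⟨u, hu⟩ ⟨w, hw⟩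
  cases p with
  | nil => exact absurd rfl hwu
  | @cons _ v _ huv _ =>
    rw [SimpleGraph.compl_adj] at huv
    exact ⟨v, fun h => huv.1 (Subtype.ext h.symm), huv.2⟩

theorem ObtainedByAddingUniversal.adj {G : SimpleGraph V} {S : Set V}
    (h : ObtainedByAddingUniversal G S) {u v : V} (hu : u ∉ S) (huv : v ≠ u) : G.Adj u v := by
  by_cases hv : v ∈ S
  · exact h.2 u hu v hv
  · exact h.1 hu hv huv.symm

/-- In an anticonnected set with two or more vertices, each vertex has a nonneighbour; vertices
outside `S` have none, so every such set lies inside `S`. -/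
theorem ObtainedByAddingUniversal.isNontrivialAnticomponent_iff {G : SimpleGraph V} {S : Set V}
    (h : ObtainedByAddingUniversal G S) (hS : Anticonnected (G.induce S)) (hnt : S.Nontrivial)
    (Q : Set V) : IsNontrivialAnticomponent G Q ↔ Q = S := by
  have sub : ∀ T : Set V, Anticonnected (G.induce T) → T.Nontrivial → T ⊆ S := by
    intro T hT hTnt u hu
    by_contra huS
    obtain ⟨v, hvu, huv⟩ := exists_not_adj_of_anticonnected hT hTnt hu
    exact huv (h.adj huS hvu)
  constructor
  · rintro ⟨hQ, hQnt⟩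
    exact hQ.eq_of_le hS (sub Q hQ.prop hQnt)
  · rintro rfl
    exact ⟨⟨hS, fun T hT hle => sub T hT (hnt.mono hle)⟩, hnt⟩

/-- A nonadjacent pair is anticonnected and extends to an anticomponent, necessarily `Q`. Hence a
vertex outside `Q` has no nonneighbour. -/
theorem obtainedByAddingUniversal_of_unique [Finite V] {G : SimpleGraph V} {Q : Set V}
    (h : ∀ Q', IsNontrivialAnticomponent G Q' → Q' = Q) : ObtainedByAddingUniversal G Q := by
  have key : ∀ u v, u ∉ Q → u ≠ v → G.Adj u v := by
    intro u v hu huv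
    by_contra hadj
    have hpair : Anticonnected (G.induce {u, v}) := by
      have huv' : (G.induce {u, v})ᶜ.Adj ⟨u, by simp⟩ ⟨v, by simp⟩ := by
        rw [SimpleGraph.compl_adj]
        exact ⟨fun h => huv (congrArg Subtype.val h), hadj⟩
      have hr : ∀ w, (G.induce {u, v})ᶜ.Reachable ⟨u, by simp⟩ w := by
        rintro ⟨w, rfl | rfl⟩
        · exact SimpleGraph.Reachable.refl _
        · exact huv'.reachable
      exact (SimpleGraph.connected_iff _).2 ⟨fun a b => (hr a).symm.trans (hr b), ⟨u, by simp⟩⟩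
    obtain ⟨T, hle, hT⟩ := Finite.exists_le_maximal
      (p := fun S : Set V => Anticonnected (G.induce S)) hpair
    have huT : u ∈ T := hle (by simp)
    have := h T ⟨hT, u, huT, v, hle (by simp), huv⟩
    exact hu (this ▸ huT)
  refine ⟨fun u hu v _ huv => key u v hu huv, fun u hu v hv => key u v hu ?_⟩
  rintro rfl
  exact hu hv

end Anticomponents

/-! ### Assembling the equivalences for the whole family -/

section Families

variable {V : Type*}

/-! Vertices of the seven-cycle in the graphs of `familyM`. -/

def M0Vertex.base : List M0Vertex := [.x 0, .x 1, .x 2, .x 3, .x 4, .x 5, .x 6]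
def M1Vertex.base : List M1Vertex := [.x 0, .x 1, .x 2, .x 3, .x 4, .x 5, .x 6]
def M2Vertex.base : List M2Vertex := [.x 0, .x 1, .x 2, .x 3, .x 4, .x 5, .x 6]
def M3Vertex.base : List M3Vertex := [.x 0, .x 1, .x 2, .x 3, .x 4, .x 5, .x 6]

/-- The inclusion of `T₀` in `T₁`. -/
def T0Vertex.toT1 : T0Vertex → T1Vertex
  | a0 => .a0 | a1 => .a1 | b0 => .b0 | b1 => .b1 | b2 => .b2 | b3 => .b3
  | c1 => .c1 | c2 => .c2 | c3 => .c3

theorem forall_option_of_list {W : Type*} {l : List W} (hl : ∀ w, w ∈ l) {p : Option W → Prop}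
    (h : ∀ w ∈ none :: l.map some, p w) (w : Option W) : p w := by
  refine h w ?_
  cases w with
  | none => simp
  | some w => simp [hl w]

/-- Every vertex of `H`, and a universal vertex, has two nonadjacent neighbours in `base`. -/
theorem exists_nonadjacent_of_list {W : Type*} [DecidableEq W] {later : W → List W}
    {l base : List W} {B : Set W} (hl : ∀ w, w ∈ l) (hB : ∀ w ∈ base, w ∈ B)
    (h : ∀ w ∈ none :: l.map some, ∃ a ∈ base, ∃ b ∈ base,
      univLater later w (some a) = true ∧ univLater later w (some b) = true ∧
        univLater later (some a) (some b) = false) (w : Option W) :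
    ∃ a ∈ B, ∃ b ∈ B,
      univClosedAdj (SimpleGraph.fromRel fun a b => b ∈ later a) w (some a) = true ∧
      univClosedAdj (SimpleGraph.fromRel fun a b => b ∈ later a) w (some b) = true ∧
      univClosedAdj (SimpleGraph.fromRel fun a b => b ∈ later a) (some a) (some b) = false := by
  simp only [univClosedAdj_fromRel]
  obtain ⟨a, ha, b, hb, h⟩ := forall_option_of_list hl h w
  exact ⟨a, hB a ha, b, hB b hb, h⟩

theorem closedAdj_cycleGraph (i j : Fin 7) : closedAdj (SimpleGraph.cycleGraph 7) i j =
    decide (i = j ∨ (SimpleGraph.cycleGraph 7).Adj i j) := by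
  simp [closedAdj]

theorem twins_cycleGraph (a b : Fin 7) (h : ∀ c, closedAdj (SimpleGraph.cycleGraph 7) a c =
    closedAdj (SimpleGraph.cycleGraph 7) b c) : a = b := by
  simp only [closedAdj_cycleGraph] at h
  revert a b
  decide

theorem closedAdj_T0 (a b : T0Vertex) : closedAdj T0 a b =
    (decide (a = b) || a.later.contains b || b.later.contains a) :=
  closedAdj_fromRel _ a b

theorem twins_T0 (a b : T0Vertex) (h : ∀ c, closedAdj T0 a c = closedAdj T0 b c) : a = b := by
  simp only [closedAdj_T0] at h
  have key : ∀ a ∈ T0Vertex.list, ∀ b ∈ T0Vertex.list, (∀ c ∈ T0Vertex.list,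
      (decide (a = c) || a.later.contains c || c.later.contains a) =
        (decide (b = c) || b.later.contains c || c.later.contains b)) → a = b := by
    decide +kernel
  exact key a a.mem_list b b.mem_list fun c _ => h c

/-- The graph `G` is a blowup of one of the target graphs, with universal vertices. -/
def IsTargetBlowup (G : SimpleGraph V) : Prop :=
  IsBlowupOn G M0 (Set.range M0Vertex.x) ∨ IsBlowupOn G M1 Set.univ ∨
    IsBlowupOn G M2 Set.univ ∨ IsBlowupOn G M3 Set.univ ∨ IsBlowupOn G T0 Set.univ ∨
    IsBlowupOn G T1 Set.univ

theorem IsBlowupOn.patternFree {W : Type*} {G : SimpleGraph V} {H : SimpleGraph W} {B : Set W}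
    (h : IsBlowupOn G H B) (hH : PatternFree (univClosedAdj H)) : PatternFree (closedAdj G) := by
  obtain ⟨φ, hφ, -⟩ := h
  exact PatternFree.comap hφ hH

/-- Freeness pulls back along the blowup map. The induced C₇ or T₀, and two nonadjacent neighbours
for each vertex, lift from attained vertices of the target. -/
theorem IsTargetBlowup.properties {G : SimpleGraph V} (h : IsTargetBlowup G) :
    PatternFree (closedAdj G) ∧ (SimpleGraph.IsIndContained (SimpleGraph.cycleGraph 7) G ∨
      SimpleGraph.IsIndContained T0 G) ∧ ∀ v, ¬ IsSimplicial G v := by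
  rcases h with h | h | h | h | h | h
  · refine ⟨h.patternFree patternFree_M0, .inl (h.isIndContained (ι := M0Vertex.x)
      Set.mem_range_self (fun a b => ?_) twins_cycleGraph), h.not_isSimplicial
      (exists_nonadjacent_of_list (base := M0Vertex.base) M0Vertex.mem_list ?_ (by decide +kernel))⟩
    · rw [closedAdj_cycleGraph, M0, closedAdj_fromRel]
      revert a b; decide +kernel
    · simp [M0Vertex.base]
  · refine ⟨h.patternFree patternFree_M1, .inl (h.isIndContained (ι := M1Vertex.x)
      (fun _ => trivial) (fun a b => ?_) twins_cycleGraph), h.not_isSimplicial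
      (exists_nonadjacent_of_list (base := M1Vertex.base) M1Vertex.mem_list (fun _ _ => trivial)
        (by decide +kernel))⟩
    rw [closedAdj_cycleGraph, M1, closedAdj_fromRel]
    revert a b; decide +kernel
  · refine ⟨h.patternFree patternFree_M2, .inl (h.isIndContained (ι := M2Vertex.x)
      (fun _ => trivial) (fun a b => ?_) twins_cycleGraph), h.not_isSimplicial
      (exists_nonadjacent_of_list (base := M2Vertex.base) M2Vertex.mem_list (fun _ _ => trivial)
        (by decide +kernel))⟩
    rw [closedAdj_cycleGraph, M2, closedAdj_fromRel]
    revert a b; decide +kernel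
  · refine ⟨h.patternFree patternFree_M3, .inl (h.isIndContained (ι := M3Vertex.x)
      (fun _ => trivial) (fun a b => ?_) twins_cycleGraph), h.not_isSimplicial
      (exists_nonadjacent_of_list (base := M3Vertex.base) M3Vertex.mem_list (fun _ _ => trivial)
        (by decide +kernel))⟩
    rw [closedAdj_cycleGraph, M3, closedAdj_fromRel]
    revert a b; decide +kernel
  · exact ⟨h.patternFree patternFree_T0, .inr (h.isIndContained (ι := id)
      (fun _ => trivial) (fun a b => rfl) twins_T0), h.not_isSimplicial
      (exists_nonadjacent_of_list (base := T0Vertex.list) T0Vertex.mem_list (fun _ _ => trivial)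
        (by decide +kernel))⟩
  · refine ⟨h.patternFree patternFree_T1, .inr (h.isIndContained (ι := T0Vertex.toT1)
      (fun _ => trivial) (fun a b => ?_) twins_T0), h.not_isSimplicial
      (exists_nonadjacent_of_list (base := T1Vertex.list) T1Vertex.mem_list (fun _ _ => trivial)
        (by decide +kernel))⟩
    rw [closedAdj_T0, T1, closedAdj_fromRel]
    have key : ∀ a ∈ T0Vertex.list, ∀ b ∈ T0Vertex.list,
        (decide (a.toT1 = b.toT1) || a.toT1.later.contains b.toT1 ||
          b.toT1.later.contains a.toT1) =
        (decide (a = b) || a.later.contains b || b.later.contains a) := by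
      decide +kernel
    exact key a a.mem_list b b.mem_list

theorem isTargetBlowup_of_properties [Finite V] {G : SimpleGraph V}
    (free : PatternFree (closedAdj G))
    (h : SimpleGraph.IsIndContained (SimpleGraph.cycleGraph 7) G ∨ SimpleGraph.IsIndContained T0 G)
    (hs : ∀ v, ¬ IsSimplicial G v) : IsTargetBlowup G := by
  rcases h with h | h
  · obtain ⟨f⟩ : Nonempty (_ ↪g _) := h
    have hc : IsCopy (closedAdj G) codeC7 fun i => f (Fin.ofNat 7 i) := by
      intro p hp q hq
      rw [closedAdj_embedding, closedAdj_cycleGraph]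
      revert p q
      decide +kernel
    rcases isBlowupOn_of_isCopy_C7 free hs hc with h | h | h | h
    · exact .inl h
    · exact .inr (.inl h)
    · exact .inr (.inr (.inl h))
    · exact .inr (.inr (.inr (.inl h)))
  · obtain ⟨f⟩ : Nonempty (_ ↪g _) := h
    -- The default `.a0` is immaterial: a copy constrains only the first nine terms.
    have hc : IsCopy (closedAdj G) codeT0 fun i => f (T0Vertex.list.getD i .a0) := by
      intro p hp q hq
      rw [closedAdj_embedding, closedAdj_T0]
      revert p q
      decide +kernel
    rcases isBlowupOn_of_isCopy_T0 free hs hc with h | h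
    · exact .inr (.inr (.inr (.inr (.inl h))))
    · exact .inr (.inr (.inr (.inr (.inr h))))

/-- The family of graphs in the theorem. -/
abbrev targetFamily : Set (Σ W : Type, SimpleGraph W) :=
  familyM ∪ {⟨T0Vertex, T0⟩, ⟨T1Vertex, T1⟩}

theorem closedAdj_induce {W : Type*} (H : SimpleGraph W) (S : Set W) (a b : S) :
    closedAdj (H.induce S) a b = closedAdj H a b := by
  rw [Bool.eq_iff_iff, closedAdj_iff, closedAdj_iff, Subtype.ext_iff]
  rfl

theorem IsBlowupOn.exists_thickening_univ {W : Type*} {G : SimpleGraph V} {H : SimpleGraph W}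
    (h : IsBlowupOn G H Set.univ) :
    ∃ S : Set V, ObtainedByAddingUniversal G S ∧ IsThickening (G.induce S) H := by
  obtain ⟨φ, hφ, hB⟩ := h
  exact IsBlowupOn.exists_thickening hφ Function.injective_id (fun _ _ => rfl)
    (fun _ w _ => ⟨w, rfl⟩) fun w => hB w trivial

theorem exists_thickening_of_isTargetBlowup {G : SimpleGraph V} (h : IsTargetBlowup G) :
    ∃ S : Set V, ObtainedByAddingUniversal G S ∧
      ∃ H ∈ targetFamily, IsThickening (G.induce S) H.2 := by
  have univ : ∀ {W : Type} {H : SimpleGraph W}, IsBlowupOn G H Set.univ →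
      (⟨W, H⟩ : Σ W : Type, SimpleGraph W) ∈ targetFamily →
      ∃ S : Set V, ObtainedByAddingUniversal G S ∧
        ∃ H ∈ targetFamily, IsThickening (G.induce S) H.2 := fun hb hmem => by
    obtain ⟨S, hS, ht⟩ := hb.exists_thickening_univ
    exact ⟨S, hS, _, hmem, ht⟩
  rcases h with ⟨φ, hφ, hB⟩ | h | h | h | h | h
  -- The deleted set is that of the vertices of `M₀` that `φ` misses; it avoids the seven-cycle
  -- because `hB` says that those vertices are attained.
  · obtain ⟨S, hS, ht⟩ := IsBlowupOn.exists_thickening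
      (K := M0.induce {w | ¬ ∃ v, φ v = some w}ᶜ) hφ Subtype.val_injective
      (fun a b => closedAdj_induce ..) (fun v w hv => ⟨⟨w, not_not_intro ⟨v, hv⟩⟩, rfl⟩)
      fun a => not_not.1 a.2
    refine ⟨S, hS, _, .inl (.inl ⟨{w | ¬ ∃ v, φ v = some w}, fun w hw => ?_, rfl⟩), ht⟩
    rcases w with i | _ | _ | _ | _ | _
    · exact absurd (hB _ ⟨i, rfl⟩) hw
    all_goals simp
  · exact univ h (.inl (.inr (by simp)))
  · exact univ h (.inl (.inr (by simp)))
  · exact univ h (.inl (.inr (by simp)))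
  · exact univ h (.inr (by simp))
  · exact univ h (.inr (by simp))

theorem IsBlowupOn.of_induce {W : Type*} {G : SimpleGraph V} {H : SimpleGraph W} {R B : Set W}
    (h : IsBlowupOn G (H.induce R) Set.univ) (hB : B ⊆ R) : IsBlowupOn G H B := by
  obtain ⟨φ, hφ, hR⟩ := h
  have key : ∀ x y : Option R, univClosedAdj (H.induce R) x y =
      univClosedAdj H (x.map Subtype.val) (y.map Subtype.val) := by
    rintro (_ | x) (_ | y)
    exacts [rfl, rfl, rfl, closedAdj_induce ..]
  refine ⟨fun v => (φ v).map Subtype.val, fun u v => (hφ u v).trans (key _ _), fun w hw => ?_⟩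
  obtain ⟨v, hv⟩ := hR ⟨w, hB hw⟩ trivial
  exact ⟨v, congrArg (Option.map Subtype.val) hv⟩

theorem isTargetBlowup_of_thickening {G : SimpleGraph V} {S : Set V}
    (hS : ObtainedByAddingUniversal G S) {H : Σ W : Type, SimpleGraph W} (hH : H ∈ targetFamily)
    (ht : IsThickening (G.induce S) H.2) : IsTargetBlowup G := by
  have hb := isBlowupOn_of_thickening hS ht
  rcases hH with (⟨R, hR, rfl⟩ | rfl | rfl | rfl) | rfl | rfl
  · refine .inl (hb.of_induce ?_)
    rintro _ ⟨i, rfl⟩ h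
    simpa using hR h
  · exact .inr (.inl hb)
  · exact .inr (.inr (.inl hb))
  · exact .inr (.inr (.inr (.inl hb)))
  · exact .inr (.inr (.inr (.inr (.inl hb))))
  · exact .inr (.inr (.inr (.inr (.inr hb))))

/-- Chains of nonadjacent vertices from `x₀` through `base` make `H.induce S` anticonnected. -/
theorem anticonnected_induce_of_list {W : Type*} [DecidableEq W] {later : W → List W}
    {l base : List W} {S : Set W} (hl : ∀ w, w ∈ l) (hS : ∀ w ∈ base, w ∈ S) {x₀ : W}
    (hx₀ : x₀ ∈ base)
    (h : ∀ w ∈ l, ∃ j ∈ base, ∃ k ∈ base, univLater later (some x₀) (some j) = false ∧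
      univLater later (some j) (some k) = false ∧ univLater later (some k) (some w) = false) :
    Anticonnected ((SimpleGraph.fromRel fun a b => b ∈ later a).induce S) ∧ Nontrivial S := by
  refine anticonnected_of_chain ⟨x₀, hS x₀ hx₀⟩ fun w => ?_
  obtain ⟨j, hj, k, hk, h⟩ := h w.1 (hl w.1)
  refine ⟨⟨j, hS j hj⟩, ⟨k, hS k hk⟩, ?_⟩
  simpa only [closedAdj_induce, ← univClosedAdj_fromRel, univClosedAdj] using h

theorem anticonnected_of_list {W : Type*} [DecidableEq W] {later : W → List W}
    {l : List W} (hl : ∀ w, w ∈ l) (x₀ : W)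
    (h : ∀ w ∈ l, ∃ j ∈ l, ∃ k ∈ l, univLater later (some x₀) (some j) = false ∧
      univLater later (some j) (some k) = false ∧ univLater later (some k) (some w) = false) :
    Anticonnected (SimpleGraph.fromRel fun a b => b ∈ later a) ∧ Nontrivial W := by
  refine anticonnected_of_chain x₀ fun w => ?_
  obtain ⟨j, -, k, -, h⟩ := h w (hl w)
  refine ⟨j, k, ?_⟩
  simpa only [← univClosedAdj_fromRel, univClosedAdj] using h

theorem anticonnected_of_mem_targetFamily {H : Σ W : Type, SimpleGraph W}
    (hH : H ∈ targetFamily) : Anticonnected H.2 ∧ Nontrivial H.1 := by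
  rcases hH with (⟨R, hR, rfl⟩ | rfl | rfl | rfl) | rfl | rfl
  -- The chains of nonadjacent vertices run through the seven-cycle only, so they survive any choice
  -- of the deleted set.
  · refine anticonnected_induce_of_list (base := M0Vertex.base) (x₀ := .x 0) M0Vertex.mem_list
      (fun w hw hwR => ?_) (by decide) (by decide +kernel)
    have := hR hwR
    revert hw this
    cases w <;> simp [M0Vertex.base]
  · exact anticonnected_of_list M1Vertex.mem_list (.x 0) (by decide +kernel)
  · exact anticonnected_of_list M2Vertex.mem_list (.x 0) (by decide +kernel)
  · exact anticonnected_of_list M3Vertex.mem_list (.x 0) (by decide +kernel)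
  · exact anticonnected_of_list T0Vertex.mem_list .a0 (by decide +kernel)
  · exact anticonnected_of_list T1Vertex.mem_list .a0 (by decide +kernel)

end Families
end EvenHole

theorem mainTheorem2 {V : Type*} [Finite V] (G : SimpleGraph V) :
    List.TFAE [
      (EvenHole.IndFree G EvenHole.twoP3 ∧
        EvenHole.IndFree G (SimpleGraph.cycleGraph 4) ∧
        EvenHole.IndFree G (SimpleGraph.cycleGraph 6)) ∧
      (SimpleGraph.IsIndContained (SimpleGraph.cycleGraph 7) G ∨
        SimpleGraph.IsIndContained EvenHole.T0 G) ∧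
      (∀ v : V, ¬ EvenHole.IsSimplicial G v),
      ∃ Q : Set V, EvenHole.IsNontrivialAnticomponent G Q ∧
        (∀ Q' : Set V, EvenHole.IsNontrivialAnticomponent G Q' → Q' = Q) ∧
        ∃ H ∈ EvenHole.familyM ∪ {⟨EvenHole.T0Vertex, EvenHole.T0⟩, ⟨EvenHole.T1Vertex, EvenHole.T1⟩},
          EvenHole.IsThickening (G.induce Q) H.2,
      ∃ S : Set V, EvenHole.ObtainedByAddingUniversal G S ∧
        ∃ H ∈ EvenHole.familyM ∪ {⟨EvenHole.T0Vertex, EvenHole.T0⟩, ⟨EvenHole.T1Vertex, EvenHole.T1⟩},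
          EvenHole.IsThickening (G.induce S) H.2] := by
  open EvenHole in
  rw [← patternFree_closedAdj_iff]
  tfae_have 1 → 3 := fun ⟨free, hind, hs⟩ =>
    exists_thickening_of_isTargetBlowup (isTargetBlowup_of_properties free hind hs)
  tfae_have 3 → 1 := fun ⟨_, hS, _, hH, ht⟩ => (isTargetBlowup_of_thickening hS hH ht).properties
  tfae_have 3 → 2 := by
    rintro ⟨S, hS, H, hH, ht⟩
    obtain ⟨hanti, hnt⟩ := anticonnected_of_mem_targetFamily hH
    have hS' := hS.isNontrivialAnticomponent_iff (ht.anticonnected hanti)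
      (Set.nontrivial_coe_sort.1 ht.nontrivial)
    exact ⟨S, (hS' S).2 rfl, fun Q => (hS' Q).1, H, hH, ht⟩
  tfae_have 2 → 3 := fun ⟨Q, _, huniq, hH⟩ =>
    ⟨Q, obtainedByAddingUniversal_of_unique huniq, hH⟩
  tfae_finish
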